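/- **Setting.** Let $(Z_t)_{t\in\mathbb Z}$ be iid real random variables with $\mathbb E Z_0=0$ and $\mathbb E Z_0^2=1$. Let $h$ be a bijection (measurable, with measurable inverse) from a Borel set $D\subseteq(0,\infty)$ onto a subset of $\mathbb R$, with inverse $\ell$ (the link function). For parameters $\theta$ in a metric space (for instance $\mathbb R^d$) let $\psi_t(x,\theta)=\psi(Z_t,x,\theta)$, with $\psi$ measurable in its first two arguments. The observations are $X_t=\sigma_tZ_t$, where $\sigma_t>0$ and $$h(\sigma_{t+1}^2)=\psi_t(h(\sigma_t^2),\theta_0),\qquad t\in\mathbb Z .$$ Replacing $Z_t$ by $X_t/\sqrt{\ell(x)}$ in $\psi_t(x,\theta)$ gives the inverted maps $\phi_t(x,\theta)=\psi\big(X_t/\sqrt{\ell(x)},x,\theta\big)$. Let $\Theta$ be a compact set of parameters, let $\mathcal K\subseteq h(D)$, and let $\mathcal C_\Theta$ be the set of continuous functions from $\Theta$ to $\mathcal K$, with uniform norm $\|\cdot\|_\Theta$. Assume that for every $t$, almost surely, $\theta\mapsto\phi_t(u(\theta),\theta)$ belongs to $\mathcal C_\Theta$ for all $u\in\mathcal C_\Theta$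 (in particular $\phi_t$ maps $\mathcal K\times\Theta$ into $\mathcal K$). For $\hat g_0\in\mathcal C_\Theta$ put $\hat g_{t+1}(\theta)=\phi_t(\hat g_t(\theta),\theta)$, $t\ge0$. **Assumptions.** * **(ST)** $(\sigma_t^2)$ is a stationary solution of the recursion above that is non anticipative ($\sigma_t^2$ is independent of $(Z_t,Z_{t+1},\dots)$ for all $t\in\mathbb Z$) and satisfies $\mathbb E\log^+\sigma_0^2<\infty$. It is the unique such solution, in the sense that any process with these properties, driven by iid innovations with the law of $Z_0$ on any probability space, has the law of $(\sigma_t^2)$; this holds in particular if the solution is almost surely unique on every probability space. * **(Continuous invertibility on $\Theta$)** For each $\theta\in\Theta$ there is a $\mathcal K$-valued solution $(g_t(\theta))_{t\in\mathbb Z}$ of $g_{t+1}(\theta)=\phi_t(g_t(\theta),\theta)$, $t\in\mathbb Z$, stationary jointly with $(X_t)$, such that for every $\hat g_0\in\mathcal C_\Theta$ one has $\|\hat g_t-g_t\|_\Theta\to0$ a.s. as $t\to\infty$. * **(LB)** The maps $x\mapsto1/\ell(x)$ and $x\mapsto\log\ell(x)$ are Lipschitz on $\mathcal K$, and there is $m>0$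 with $\ell(x)\ge m$ for all $x\in\mathcal K$. * **(ID)** For $\theta\in\Theta$: $\ell(g_0(\theta))=\sigma_0^2$ a.s. if and only if $\theta=\theta_0$. **Theorem 3.1.** Assume (ST), (LB), (ID), that the model is continuously invertible on the compact set $\Theta$, and that $\theta_0\in\Theta$. Let $\hat g_0\in\mathcal C_\Theta$ be arbitrary and, for each $n\ge1$, let $\hat\theta_n\in\Theta$ almost surely minimize over $\Theta$ the quasi-likelihood criterion $$\hat L_n(\theta)=\frac1{2n}\sum_{t=1}^n\Big(\frac{X_t^2}{\ell(\hat g_t(\theta))}+\log\ell(\hat g_t(\theta))\Big).$$ Then the QMLE is strongly consistent: $\hat\theta_n\to\theta_0$ a.s. as $n\to\infty$. -/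

import Mathlib

open MeasureTheory ProbabilityTheory Filter Topology
open scoped NNReal ENNReal

/-- The innovations: real, iid, centered, with unit variance, indexed by `ℤ`. -/
structure IsInnovation {Ω : Type*} [MeasurableSpace Ω] (P : Measure Ω) (Z : ℤ → Ω → ℝ) :
    Prop where
  measurable : ∀ t, Measurable (Z t)
  indep : iIndepFun Z P
  identDistrib : ∀ t, IdentDistrib (Z t) (Z 0) P P
  memLp : MemLp (Z 0) 2 P
  mean : ∫ ω, Z 0 ω ∂P = 0
  variance : ∫ ω, Z 0 ω ^ 2 ∂P = 1

/-- Strict stationarity: the law of the whole process is invariant under time shifts. -/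
def IsStationaryProcess {Ω α : Type*} [MeasurableSpace Ω] [MeasurableSpace α] (P : Measure Ω)
    (Y : ℤ → Ω → α) : Prop :=
  ∀ k : ℤ, IdentDistrib (fun ω (t : ℤ) => Y (t + k) ω) (fun ω (t : ℤ) => Y t ω) P P

/-- A general volatility model driven by a stochastic recurrence equation, with parameter in `E`.
`h` is a bijection from `h.source ⊆ (0, ∞)` onto `h.target ⊆ ℝ`, and `ψ z x θ` is the value at
`(x, θ)` of the random map `ψ_t` when the innovation `Z_t` equals `z`.  The values of `h`, `h.symm`
and `ψ` off these domains play no role. -/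
structure VolatilityModel (E : Type*) where
  h : PartialEquiv ℝ ℝ
  source_pos : h.source ⊆ Set.Ioi 0
  measurableSet_source : MeasurableSet h.source
  measurable_h : Measurable h
  measurable_symm : Measurable h.symm
  ψ : ℝ → ℝ → E → ℝ
  measurable_ψ : ∀ θ, Measurable (fun p : ℝ × ℝ => ψ p.1 p.2 θ)

namespace VolatilityModel

variable {E : Type*}

/-- The link function `ℓ`, inverse of `h`. -/
def link (M : VolatilityModel E) : ℝ → ℝ := M.h.symm

/-- The inverted map `φ`: in `ψ` the innovation is replaced by `ξ / σ`, where `ξ` is the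
observation and `σ ^ 2 = ℓ x`.  Thus `φ_t(x, θ) = M.φ (X_t) x θ`. -/
noncomputable def φ (M : VolatilityModel E) (ξ x : ℝ) (θ : E) : ℝ :=
  M.ψ (ξ / √(M.link x)) x θ

/-- `S t` (standing for `σ_t ^ 2`) is a stationary solution of
`h (σ_{t+1} ^ 2) = ψ_t (h (σ_t ^ 2), θ₀)`, `t ∈ ℤ`, that is non anticipative and has a finite
log-moment. -/
structure IsSolution (M : VolatilityModel E) (θ₀ : E) {Ω : Type*} [MeasurableSpace Ω]
    (P : Measure Ω) (Z S : ℤ → Ω → ℝ) : Prop where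
  measurable : ∀ t, Measurable (S t)
  mem_source : ∀ t, ∀ᵐ ω ∂P, S t ω ∈ M.h.source
  recursion : ∀ t, ∀ᵐ ω ∂P, M.h (S (t + 1) ω) = M.ψ (Z t ω) (M.h (S t ω)) θ₀
  stationary : IsStationaryProcess P S
  nonanticipative : ∀ t : ℤ, IndepFun (S t) (fun ω (n : ℕ) => Z (t + n) ω) P
  log_moment : Integrable (fun ω => Real.posLog (S 0 ω)) P

/-- Condition (ST).  Uniqueness is uniqueness in law: every solution with these properties, driven
by iid innovations with the given marginal law on any probability space, has the law of `S`.
This is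
implied by almost sure uniqueness of the solution on every probability space. -/
structure ST (M : VolatilityModel E) (θ₀ : E) {Ω : Type*} [MeasurableSpace Ω]
    (P : Measure Ω) (Z S : ℤ → Ω → ℝ) : Prop where
  isSolution : M.IsSolution θ₀ P Z S
  unique : ∀ (Ω' : Type) [MeasurableSpace Ω'] (P' : Measure Ω') [IsProbabilityMeasure P']
    (Z' S' : ℤ → Ω' → ℝ), IsInnovation P' Z' → IdentDistrib (Z' 0) (Z 0) P' P →
    M.IsSolution θ₀ P' Z' S' →
    IdentDistrib (fun ω (t : ℤ) => S' t ω) (fun ω (t : ℤ) => S t ω) P' P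

/-- Condition (LB) on the link function. -/
def LB (M : VolatilityModel E) (K : Set ℝ) : Prop :=
  (∃ C : ℝ≥0, LipschitzOnWith C (fun x => 1 / M.link x) K) ∧
  (∃ C : ℝ≥0, LipschitzOnWith C (fun x => Real.log (M.link x)) K) ∧
  ∃ m : ℝ, 0 < m ∧ ∀ x ∈ K, m ≤ M.link x

/-- Condition (ID), where `g₀ θ` is the time-zero value of the stationary solution of the inverted
recursion at `θ`, and `S₀ = σ_0 ^ 2`. -/
def ID (M : VolatilityModel E) (θ₀ : E) (Θ : Set E) {Ω : Type*} [MeasurableSpace Ω]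
    (P : Measure Ω) (g₀ : E → Ω → ℝ) (S₀ : Ω → ℝ) : Prop :=
  ∀ θ ∈ Θ, (∀ᵐ ω ∂P, M.link (g₀ θ ω) = S₀ ω) ↔ θ = θ₀

/-- The space `C_Θ` of functions that are continuous on `Θ` with values in `K`. -/
def contSpace [TopologicalSpace E] (Θ : Set E) (K : Set ℝ) : Set (E → ℝ) :=
  {u | ContinuousOn u Θ ∧ Set.MapsTo u Θ K}

/-- Uniform norm on `Θ`, in `[0, ∞]`. -/
noncomputable def supNorm (Θ : Set E) (f : E → ℝ) : ℝ≥0∞ := ⨆ θ ∈ Θ, ‖f θ‖ₑ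

/-- The recursion `ĝ_{t+1}(θ) = φ_t (ĝ_t(θ), θ)`, `t ≥ 0`, along the observed path `x`, started
at the function `u`. -/
noncomputable def gHat (M : VolatilityModel E) (x : ℤ → ℝ) (u : E → ℝ) : ℕ → E → ℝ
  | 0 => u
  | t + 1 => fun θ => M.φ (x t) (M.gHat x u t θ) θ

/-- Almost surely, the inverted recursion sends functions in `C_Θ` to functions in `C_Θ`. (Taking
constant functions: `φ_t` maps `K × Θ` into `K`.) -/
def PreservesContSpace [TopologicalSpace E] (M : VolatilityModel E) (Θ : Set E) (K : Set ℝ)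
    {Ω : Type*} [MeasurableSpace Ω] (P : Measure Ω) (X : ℤ → Ω → ℝ) : Prop :=
  ∀ t, ∀ᵐ ω ∂P, ∀ u ∈ contSpace Θ K, (fun θ => M.φ (X t ω) (u θ) θ) ∈ contSpace Θ K

/-- At each `θ ∈ Θ`, `(g_t(θ))` is a `K`-valued stationary solution of
`g_{t+1}(θ) = φ_t (g_t(θ), θ)`, `t ∈ ℤ`; stationarity is joint with the driving observations. -/
structure IsStationaryFilter (M : VolatilityModel E) (Θ : Set E) (K : Set ℝ)
    {Ω : Type*} [MeasurableSpace Ω] (P : Measure Ω) (X : ℤ → Ω → ℝ) (g : ℤ → E → Ω → ℝ) :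
    Prop where
  measurable : ∀ t, ∀ θ ∈ Θ, Measurable (g t θ)
  mem : ∀ t, ∀ θ ∈ Θ, ∀ᵐ ω ∂P, g t θ ω ∈ K
  recursion : ∀ t, ∀ θ ∈ Θ, ∀ᵐ ω ∂P, g (t + 1) θ ω = M.φ (X t ω) (g t θ ω) θ
  stationary : ∀ θ ∈ Θ, IsStationaryProcess P (fun t ω => (g t θ ω, X t ω))

/-- Continuous invertibility on `Θ`, with limit `g`: from every initial function in `C_Θ`,
`‖ĝ_t - g_t‖_Θ → 0` almost surely. -/
structure ContinuouslyInvertible [TopologicalSpace E] (M : VolatilityModel E) (Θ : Set E)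
    (K : Set ℝ) {Ω : Type*} [MeasurableSpace Ω] (P : Measure Ω) (X : ℤ → Ω → ℝ)
    (g : ℤ → E → Ω → ℝ) : Prop where
  isStationaryFilter : M.IsStationaryFilter Θ K P X g
  tendsto : ∀ u ∈ contSpace Θ K, ∀ᵐ ω ∂P,
    Tendsto (fun t : ℕ => supNorm Θ (fun θ => M.gHat (fun s => X s ω) u t θ - g t θ ω))
      atTop (𝓝 0)

/-- The quasi-likelihood criterion `L̂_n(θ)`, with
`2 n L̂_n(θ) = ∑_{t=1}^n (X_t ^ 2 / ℓ(ĝ_t(θ)) + log ℓ(ĝ_t(θ)))`. -/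
noncomputable def quasiLik (M : VolatilityModel E) (x : ℤ → ℝ) (u : E → ℝ) (n : ℕ) (θ : E) : ℝ :=
  (∑ t ∈ Finset.Icc 1 n,
    (x t ^ 2 / M.link (M.gHat x u t θ) + Real.log (M.link (M.gHat x u t θ)))) / (2 * n)

/-- `θhat` minimizes `L̂_n` over `Θ`. -/
def IsQMLE (M : VolatilityModel E) (Θ : Set E) (x : ℤ → ℝ) (u : E → ℝ) (n : ℕ) (θhat : E) :
    Prop :=
  θhat ∈ Θ ∧ ∀ θ ∈ Θ, M.quasiLik x u n θhat ≤ M.quasiLik x u n θ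

end VolatilityModel

/-! Write `r = σ_0² / ℓ(g_0(θ))`. Since `Z_0` is independent of `σ_0²` and of the past, which
determines `g_0(θ)`, the expected contribution at `θ`, when finite, exceeds `1 + E log σ_0²` by `E[r
- 1 - log r] ≥ 0`. Equality forces `r = 1` almost surely, which (ID) allows only at `θ₀`. It remains
to pass from expectations to averages, locally uniformly in `θ`.

Ergodicity comes from uniqueness in law. A shift-invariant event of positive probability is
approximated by events of the past, hence is independent of future innovations. Conditioning on it
therefore gives another admissible solution with the same innovation law. By uniqueness the
conditioned law equals the original one, so the event has probability one (`IsSolution.cond`,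
`ST.ergodic`), and Birkhoff's theorem applies.

Two difficulties come from the weak assumptions. First, `X_t²` need not be integrable. At `θ₀` the
Lipschitz bound on `log ℓ` controls `σ_t² / ℓ(ĝ_t(θ₀))` by `exp(C |ĝ_t - g_t|)`, leaving weighted
averages of `Z_t²`. Elsewhere the contributions are truncated, which is enough for a lower bound.

Second, `g_t` is not assumed continuous in `θ`. Its oscillation near `θ`, in the limit of small
radius, is at most twice its uniform distance to the continuous function `ĝ_t`, and so tends to zero
along time. By stationarity the expectation of this limit is constant in time, hence zero, so small
neighbourhoods have small expected truncated oscillation. This gives local separation from `θ₀`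
(`exists_ball_quasiLik_lt`), and compactness concludes. -/

/-! ### Birkhoff's pointwise ergodic theorem. -/

section Birkhoff

variable {α : Type*}

/-- The running maximum `max (0, f, f + f ∘ T, …)` of the first `n` Birkhoff sums, defined through
its recursion. -/
def birkhoffMax (T : α → α) (f : α → ℝ) : ℕ → α → ℝ
  | 0 => fun _ => 0
  | n + 1 => fun x => max 0 (f x + birkhoffMax T f n (T x))

lemma birkhoffMax_nonneg (T : α → α) (f : α → ℝ) (n : ℕ) (x : α) : 0 ≤ birkhoffMax T f n x := by
  cases n with
  | zero => exact le_rfl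
  | succ n => exact le_max_left _ _

lemma birkhoffMax_le_succ (T : α → α) (f : α → ℝ) (n : ℕ) (x : α) :
    birkhoffMax T f n x ≤ birkhoffMax T f (n + 1) x := by
  induction n generalizing x with
  | zero => exact birkhoffMax_nonneg T f 1 x
  | succ n ih => exact max_le_max le_rfl (by linarith [ih (T x)])

lemma birkhoffSum_le_birkhoffMax (T : α → α) (f : α → ℝ) (n : ℕ) (x : α) :
    birkhoffSum T f n x ≤ birkhoffMax T f n x := by
  induction n generalizing x with
  | zero => simp [birkhoffMax]
  | succ n ih =>
    rw [birkhoffSum_succ']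
    exact le_max_of_le_right (by linarith [ih (T x)])

variable [MeasurableSpace α] {μ : Measure α} {T : α → α} {f : α → ℝ}

lemma measurable_birkhoffMax (hT : Measurable T) (hf : Measurable f) (n : ℕ) :
    Measurable (birkhoffMax T f n) := by
  induction n with
  | zero => exact measurable_const
  | succ n ih => exact measurable_const.max (hf.add (ih.comp hT))

lemma integrable_birkhoffMax [IsFiniteMeasure μ] (hT : MeasurePreserving T μ μ)
    (hf : Integrable f μ) (n : ℕ) : Integrable (birkhoffMax T f n) μ := by
  induction n with
  | zero => exact integrable_const 0
  | succ n ih =>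
    exact (integrable_const (0 : ℝ)).sup (hf.add (hT.integrable_comp_of_integrable ih))

/-- If `∫ f < 0` and `T` is ergodic, the Birkhoff sums of `f` are almost
everywhere bounded above. -/
theorem Ergodic.ae_bddAbove_birkhoffSum [IsProbabilityMeasure μ] (hT : Ergodic T μ)
    (hfm : Measurable f) (hf : Integrable f μ) (hneg : ∫ x, f x ∂μ < 0) :
    ∀ᵐ x ∂μ, ∃ C : ℝ, ∀ n, birkhoffSum T f n x ≤ C := by
  have hTp := hT.toMeasurePreserving
  set A : Set α := {x | ∀ C : ℕ, ∃ n, (C : ℝ) < birkhoffMax T f n x} with hA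
  have hAm : MeasurableSet A := by
    have : A = ⋂ C : ℕ, ⋃ n : ℕ, {x | (C : ℝ) < birkhoffMax T f n x} := by ext; simp [hA]
    rw [this]
    exact .iInter fun C => .iUnion fun n =>
      measurableSet_lt measurable_const (measurable_birkhoffMax hT.measurable hfm n)
  -- The running maxima at `x` and at `T x` differ by a bounded amount depending on `f x`, up to one
  -- step in the index, so they are unbounded together.
  have hAinv : T ⁻¹' A = A := by
    ext x
    simp only [hA, Set.mem_preimage, Set.mem_ofPred_eq]
    constructor
    · intro h C
      obtain ⟨D, hD⟩ := exists_nat_ge (C - f x)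
      obtain ⟨n, hn⟩ := h D
      exact ⟨n + 1, lt_max_of_lt_right (by linarith)⟩
    · intro h C
      obtain ⟨D, hD⟩ := exists_nat_ge (C + |f x|)
      obtain ⟨n, hn⟩ := h D
      refine ⟨n, ?_⟩
      have h1 := hn.trans_le (birkhoffMax_le_succ T f n x)
      have h2 : birkhoffMax T f (n + 1) x ≤ |f x| + birkhoffMax T f n (T x) :=
        max_le (add_nonneg (abs_nonneg _) (birkhoffMax_nonneg _ _ _ _))
          (by linarith [le_abs_self (f x)])
      linarith
  rcases hT.ae_mem_or_ae_notMem hAm hAinv with h | h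
  · exfalso
    -- Garsia's argument: where the maxima are unbounded, the maximum with `0` in the recursion is
    -- eventually inactive and the difference equals `f x`; it is always dominated by `|f x|`.
    have hlim : Tendsto (fun n => ∫ x, (birkhoffMax T f (n + 1) x - birkhoffMax T f n (T x)) ∂μ)
        atTop (𝓝 (∫ x, f x ∂μ)) := by
      refine tendsto_integral_of_dominated_convergence (fun x => |f x|) (fun n => ?_) hf.abs
        (fun n => ?_) ?_
      · exact ((measurable_birkhoffMax hT.measurable hfm _).sub
          ((measurable_birkhoffMax hT.measurable hfm n).comp
            hT.measurable)).aestronglyMeasurable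
      · refine ae_of_all _ fun x => ?_
        have h0 := birkhoffMax_nonneg T f n (T x)
        rw [Real.norm_eq_abs]
        simp only [birkhoffMax]
        rcases max_cases 0 (f x + birkhoffMax T f n (T x)) with ⟨h1, h2⟩ | ⟨h1, h2⟩ <;> rw [h1]
        · rw [abs_of_nonpos (by linarith)]
          linarith [neg_le_abs (f x)]
        · rw [add_sub_cancel_right]
      · filter_upwards [h] with x hx
        obtain ⟨D, hD⟩ := exists_nat_ge (|f x|)
        have hxT : T x ∈ A := by rw [← hAinv] at hx; exact hx
        obtain ⟨n₀, hn₀⟩ := hxT D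
        refine tendsto_const_nhds.congr' ?_
        filter_upwards [eventually_ge_atTop n₀] with n hn
        have hmono : Monotone fun n => birkhoffMax T f n (T x) :=
          monotone_nat_of_le_succ fun n => birkhoffMax_le_succ T f n (T x)
        have h1 : birkhoffMax T f n₀ (T x) ≤ birkhoffMax T f n (T x) := hmono hn
        simp only [birkhoffMax]
        rw [max_eq_right (by linarith [neg_le_abs (f x)]), add_sub_cancel_right]
    -- Invariance removes `T` under the integral, and the running maxima increase with `n`; this
    -- contradicts the negative limit.
    have hge : ∀ n, 0 ≤ ∫ x, (birkhoffMax T f (n + 1) x - birkhoffMax T f n (T x)) ∂μ := by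
      intro n
      have hi := integrable_birkhoffMax hTp hf
      have hiT : Integrable (fun x => birkhoffMax T f n (T x)) μ :=
        hTp.integrable_comp_of_integrable (hi n)
      rw [integral_sub (hi _) hiT]
      have h1 : ∫ x, birkhoffMax T f n (T x) ∂μ = ∫ x, birkhoffMax T f n x ∂μ := by
        rw [← integral_map hT.measurable.aemeasurable, hTp.map_eq]
        exact (measurable_birkhoffMax hT.measurable hfm n).aestronglyMeasurable
      rw [h1, sub_nonneg]
      exact integral_mono (hi _) (hi _) fun x => birkhoffMax_le_succ T f n x
    exact absurd (ge_of_tendsto' hlim hge) (not_le.2 hneg)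
  · filter_upwards [h] with x hx
    simp only [hA, Set.mem_ofPred_eq, not_forall, not_exists, not_lt] at hx
    obtain ⟨C, hC⟩ := hx
    exact ⟨C, fun n => (birkhoffSum_le_birkhoffMax T f n x).trans (hC n)⟩

/-- Subtracting a constant slightly above the mean makes the integral negative, so the recentred
sums are bounded above, and the bound disappears after division by `n`. Half of `ε` is spent on each
of these. -/
lemma Ergodic.ae_eventually_birkhoffSum_le [IsProbabilityMeasure μ] (hT : Ergodic T μ)
    (hfm : Measurable f) (hf : Integrable f μ) {ε : ℝ} (hε : 0 < ε) :
    ∀ᵐ x ∂μ, ∀ᶠ n : ℕ in atTop, birkhoffSum T f n x / n ≤ ∫ x, f x ∂μ + ε := by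
  set c := ∫ x, f x ∂μ + ε / 2 with hc
  have hint : ∫ x, (f x - c) ∂μ < 0 := by
    rw [integral_sub hf (integrable_const _)]
    simp [hc, hε]
  filter_upwards [hT.ae_bddAbove_birkhoffSum (f := fun x => f x - c) (hfm.sub_const c)
    (hf.sub (integrable_const c)) hint] with x ⟨C, hC⟩
  have hlim : Tendsto (fun n : ℕ => C / (n : ℝ)) atTop (𝓝 0) :=
    tendsto_const_nhds.div_atTop tendsto_natCast_atTop_atTop
  filter_upwards [hlim.eventually (gt_mem_nhds (half_pos hε)), eventually_gt_atTop 0]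
    with n hn hn0
  have hn0' : (0 : ℝ) < n := by exact_mod_cast hn0
  have h1 := hC n
  simp only [birkhoffSum, Finset.sum_sub_distrib, Finset.sum_const, Finset.card_range,
    nsmul_eq_mul] at h1 ⊢
  rw [div_lt_iff₀ hn0'] at hn
  rw [div_le_iff₀ hn0']
  nlinarith

/-- Birkhoff's pointwise ergodic theorem for an ergodic transformation. -/
theorem Ergodic.ae_tendsto_birkhoffSum_div [IsProbabilityMeasure μ] (hT : Ergodic T μ)
    (hfm : Measurable f) (hf : Integrable f μ) :
    ∀ᵐ x ∂μ, Tendsto (fun n : ℕ => birkhoffSum T f n x / n) atTop (𝓝 (∫ x, f x ∂μ)) := by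
  have hpos : ∀ k : ℕ, (0 : ℝ) < 1 / (k + 1) := fun k => Nat.one_div_pos_of_nat
  have hup := ae_all_iff.2 fun k : ℕ => hT.ae_eventually_birkhoffSum_le hfm hf (hpos k)
  have hlo := ae_all_iff.2 fun k : ℕ =>
    hT.ae_eventually_birkhoffSum_le hfm.neg hf.neg (hpos k)
  filter_upwards [hup, hlo] with x hx1 hx2
  rw [Metric.tendsto_atTop']
  intro ε hε
  obtain ⟨k, hk⟩ := exists_nat_one_div_lt hε
  obtain ⟨N, hN⟩ := eventually_atTop.1 ((hx1 k).and (hx2 k))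
  refine ⟨N, fun n hn => ?_⟩
  obtain ⟨h1, h2⟩ := hN n hn.le
  have h3 : birkhoffSum T (-f) n x = -birkhoffSum T f n x := by simp [birkhoffSum]
  have h4 : ∫ x, (-f) x ∂μ = -∫ x, f x ∂μ := integral_neg f
  rw [h3, h4, neg_div] at h2
  rw [Real.dist_eq, abs_lt]
  constructor <;> linarith

end Birkhoff

/-! ### Shifts, pasts and futures of two-sided sequences. -/

section TwoSided

variable {α : Type*}

/-- The future `(y t, y (t + 1), …)` of a two-sided sequence from time `t` on. -/
def futurePath (t : ℤ) (y : ℤ → α) : ℕ → α := fun n => y (t + n)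

/-- The past `(y (t - 1), y (t - 2), …)` of a two-sided sequence strictly before time `t`. -/
def pastPath (t : ℤ) (y : ℤ → α) : ℕ → α := fun n => y (t - 1 - n)

/-- The time shift by `k` on two-sided sequences. -/
def pathShift (k : ℤ) (y : ℤ → α) : ℤ → α := fun t => y (t + k)

lemma futurePath_pathShift (t k : ℤ) (y : ℤ → α) :
    futurePath t (pathShift k y) = futurePath (t + k) y := by
  funext n; simp only [futurePath, pathShift]; congr 1; ring

lemma pastPath_pathShift (t k : ℤ) (y : ℤ → α) :
    pastPath t (pathShift k y) = pastPath (t + k) y := by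
  funext n; simp only [pastPath, pathShift]; congr 1; ring

lemma pathShift_pathShift (k l : ℤ) (y : ℤ → α) :
    pathShift k (pathShift l y) = pathShift (k + l) y := by
  funext n; simp only [pathShift]; congr 1; ring

lemma iterate_pathShift_one (n : ℕ) (y : ℤ → α) : (pathShift 1)^[n] y = pathShift n y := by
  induction n with
  | zero => funext t; simp [pathShift]
  | succ n ih =>
    rw [Function.iterate_succ_apply', ih, pathShift_pathShift]
    push_cast
    rw [add_comm]

/-- The shift is invertible on two-sided sequences, so invariance extends to negative `k`; moving an
event into the past requires this. -/
lemma preimage_pathShift_of_invariant {B : Set (ℤ → α)} (hB : pathShift 1 ⁻¹' B = B) (k : ℤ) :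
    pathShift k ⁻¹' B = B := by
  have hcomp : ∀ k l : ℤ, pathShift k ⁻¹' (pathShift l ⁻¹' B) = pathShift (l + k) ⁻¹' B := by
    intro k l; ext y; simp [pathShift_pathShift]
  have h0 : pathShift (0 : ℤ) ⁻¹' B = B := by
    ext y
    have : pathShift 0 y = y := by funext t; simp [pathShift]
    simp [this]
  induction k with
  | zero => exact h0
  | succ n ih =>
    have := hcomp n 1
    rw [hB, ih] at this
    rw [add_comm]; exact this.symm
  | pred n ih =>
    have := hcomp (-n - 1) 1
    rw [hB] at this
    rw [this, ← ih]; congr 2; ring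

variable [MeasurableSpace α]

@[fun_prop]
lemma measurable_futurePath (t : ℤ) : Measurable (futurePath t : (ℤ → α) → ℕ → α) := by
  unfold futurePath; fun_prop

@[fun_prop]
lemma measurable_pastPath (t : ℤ) : Measurable (pastPath t : (ℤ → α) → ℕ → α) := by
  unfold pastPath; fun_prop

@[fun_prop]
lemma measurable_pathShift (k : ℤ) : Measurable (pathShift k : (ℤ → α) → ℤ → α) := by
  unfold pathShift; fun_prop

/-- A finite measure on two-sided sequences is determined by the laws of its futures. -/
lemma measure_ext_of_map_futurePath {μ ν : Measure (ℤ → α)} [IsFiniteMeasure μ]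
    [IsFiniteMeasure ν] (h : ∀ t, μ.map (futurePath t) = ν.map (futurePath t)) : μ = ν := by
  refine IsProjectiveLimit.unique (P := fun I => ν.map I.restrict) (fun I => ?_) (fun I => rfl)
  obtain ⟨t, ht⟩ := I.bddBelow
  have hr : (I.restrict : (ℤ → α) → (I → α)) =
      (fun (z : ℕ → α) (i : I) => z ((i : ℤ) - t).toNat) ∘ futurePath t := by
    funext y i
    have hi : t ≤ i := ht i.2
    simp only [Finset.restrict, Function.comp, futurePath]
    congr 1; omega
  have hm : Measurable (fun (z : ℕ → α) (i : I) => z ((i : ℤ) - t).toNat) := by fun_prop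
  simp only [hr]
  rw [← Measure.map_map hm (measurable_futurePath t), h,
    Measure.map_map hm (measurable_futurePath t)]

end TwoSided

/-! ### Independence of innovations from the past. -/

section Independence

variable {Ω β γ δ : Type*} [MeasurableSpace Ω] [MeasurableSpace β] [MeasurableSpace γ]
  [MeasurableSpace δ] {P : Measure Ω}

/-- The two hypotheses make the law of the triple a full product, which may be bracketed either way.
It serves to move one innovation from the future side to the past side. -/
lemma ProbabilityTheory.IndepFun.prodMk_left_of_indepFun [IsProbabilityMeasure P] {W : Ω → β}
    {A : Ω → γ} {B : Ω → δ} (hW : Measurable W) (hA : Measurable A) (hB : Measurable B)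
    (h1 : IndepFun W (fun ω => (A ω, B ω)) P) (h2 : IndepFun A B P) :
    IndepFun (fun ω => (W ω, A ω)) B P := by
  have hWA : IndepFun W A P := h1.comp measurable_id measurable_fst
  have e1 := (indepFun_iff_map_prod_eq_prod_map_map hW.aemeasurable
    (hA.prodMk hB).aemeasurable).1 h1
  have e2 := (indepFun_iff_map_prod_eq_prod_map_map hA.aemeasurable hB.aemeasurable).1 h2
  have e3 := (indepFun_iff_map_prod_eq_prod_map_map hW.aemeasurable hA.aemeasurable).1 hWA
  have := Measure.isProbabilityMeasure_map hW.aemeasurable (μ := P)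
  have := Measure.isProbabilityMeasure_map hA.aemeasurable (μ := P)
  have := Measure.isProbabilityMeasure_map hB.aemeasurable (μ := P)
  rw [indepFun_iff_map_prod_eq_prod_map_map (hW.prodMk hA).aemeasurable hB.aemeasurable, e3]
  rw [e2, ← Measure.prodAssoc_prod] at e1
  have e4 := congrArg (Measure.map MeasurableEquiv.prodAssoc.symm) e1
  rw [Measure.map_map (by fun_prop) (by fun_prop), Measure.map_map (by fun_prop) (by fun_prop)]
    at e4
  rw [MeasurableEquiv.symm_comp_self, Measure.map_id] at e4
  exact e4

lemma ProbabilityTheory.iIndepFun.indepFun_futurePath {Z : ℤ → Ω → β} (hZ : ∀ t, Measurable (Z t))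
    (h : iIndepFun Z P) (t : ℤ) :
    IndepFun (Z t) (fun ω => futurePath (t + 1) (fun s => Z s ω)) P := by
  have hd : Disjoint ({t} : Set ℤ) (Set.Ioi t) := by simp
  have hi := indep_iSup_of_disjoint (fun s => (hZ s).comap_le) h.iIndep hd
  refine indep_of_indep_of_le hi (by simp) ?_
  rw [← measurable_iff_comap_le]
  refine @measurable_pi_lambda _ _ _ (_) _ _ fun n => ?_
  refine measurable_iff_comap_le.2 ?_
  exact le_iSup₂_of_le (f := fun i (_ : i ∈ Set.Ioi t) => MeasurableSpace.comap (Z i) _)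
    (t + 1 + n) (by simp; omega) le_rfl

end Independence

/-! ### Joint law of the volatility and the innovations. -/

/-- The path `s, Φ s z₀, Φ (Φ s z₀) z₁, …` of the recursion `Φ` driven by `z`. -/
def forwardPath (Φ : ℝ → ℝ → ℝ) (s : ℝ) (z : ℕ → ℝ) : ℕ → ℝ
  | 0 => s
  | n + 1 => Φ (forwardPath Φ s z n) (z n)

lemma measurable_forwardPath {Φ : ℝ → ℝ → ℝ} (hΦ : Measurable (fun p : ℝ × ℝ => Φ p.1 p.2))
    (n : ℕ) : Measurable (fun p : ℝ × (ℕ → ℝ) => forwardPath Φ p.1 p.2 n) := by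
  induction n with
  | zero => exact measurable_fst
  | succ n ih => exact hΦ.comp (ih.prodMk (by fun_prop : Measurable fun p : ℝ × (ℕ → ℝ) => p.2 n))

namespace VolatilityModel

variable {E : Type*}

/-- The map `(σ_t ^ 2, Z_t) ↦ σ_{t+1} ^ 2`. -/
def volStep (M : VolatilityModel E) (θ₀ : E) (s z : ℝ) : ℝ := M.link (M.ψ z (M.h s) θ₀)

lemma measurable_volStep (M : VolatilityModel E) (θ₀ : E) :
    Measurable (fun p : ℝ × ℝ => M.volStep θ₀ p.1 p.2) :=
  M.measurable_symm.comp ((M.measurable_ψ θ₀).comp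
    (measurable_snd.prodMk (M.measurable_h.comp measurable_fst)))

/-- The law of `(σ_{t+n} ^ 2, Z_{t+n})_{n ≥ 0}` when `σ_t ^ 2` has law `π` and the innovations have
law `ζ`. -/
noncomputable def forwardLaw (M : VolatilityModel E) (θ₀ : E) (π ζ : Measure ℝ) :
    Measure (ℕ → ℝ × ℝ) :=
  (π.prod (Measure.infinitePi fun _ : ℕ => ζ)).map
    fun p n => (forwardPath (M.volStep θ₀) p.1 p.2 n, p.2 n)

variable {Ω : Type*} [MeasurableSpace Ω] {P : Measure Ω} {M : VolatilityModel E} {θ₀ : E}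
  {Z S : ℤ → Ω → ℝ}

/-- The two-sided path of the pair `(σ_t ^ 2, Z_t)`. -/
def pairPath (S Z : ℤ → Ω → ℝ) (ω : Ω) : ℤ → ℝ × ℝ := fun t => (S t ω, Z t ω)

lemma IsSolution.measurable_pairPath (h : M.IsSolution θ₀ P Z S) (hZ : IsInnovation P Z) :
    Measurable (pairPath S Z) :=
  measurable_pi_lambda _ fun t => (h.measurable t).prodMk (hZ.measurable t)

lemma IsSolution.step (h : M.IsSolution θ₀ P Z S) (t : ℤ) :
    ∀ᵐ ω ∂P, S (t + 1) ω = M.volStep θ₀ (S t ω) (Z t ω) := by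
  filter_upwards [h.recursion t, h.mem_source (t + 1)] with ω h1 h2
  rw [volStep, ← h1, link, M.h.left_inv h2]

lemma IsSolution.eq_forwardPath (h : M.IsSolution θ₀ P Z S) (t : ℤ) :
    ∀ᵐ ω ∂P, ∀ n : ℕ, S (t + n) ω =
      forwardPath (M.volStep θ₀) (S t ω) (fun n => Z (t + n) ω) n := by
  filter_upwards [ae_all_iff.2 fun n : ℕ => h.step (t + n)] with ω hω n
  induction n with
  | zero => simp [forwardPath]
  | succ n ih =>
    rw [forwardPath, ← ih, ← hω n]
    congr 1; push_cast; ring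

lemma IsSolution.map_eq (h : M.IsSolution θ₀ P Z S) (t : ℤ) : P.map (S t) = P.map (S 0) := by
  have := ((h.stationary t).comp (measurable_pi_apply (0 : ℤ))).map_eq
  simpa [Function.comp_def] using this

lemma _root_.IsInnovation.map_futurePath [IsProbabilityMeasure P] (hZ : IsInnovation P Z) (t : ℤ) :
    P.map (fun ω (n : ℕ) => Z (t + n) ω) = Measure.infinitePi fun _ : ℕ => P.map (Z 0) := by
  have hinj : Function.Injective fun n : ℕ => t + (n : ℤ) := fun a b hab => by simpa using hab
  have := (hZ.indep.precomp hinj).map_fun_eq_infinitePi_map fun n => hZ.measurable _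
  refine this.trans ?_
  congr 1; funext n
  exact (hZ.identDistrib _).map_eq

/-- Non-anticipation makes `σ_t²` and the innovations from `t` on a product, and the recursion
builds the whole future from them. Hence the law depends neither on `t` nor on anything beyond the
two marginals. -/
lemma IsSolution.map_futurePath [IsProbabilityMeasure P] (h : M.IsSolution θ₀ P Z S)
    (hZ : IsInnovation P Z) (t : ℤ) :
    P.map (fun ω => futurePath t (pairPath S Z ω)) =
      M.forwardLaw θ₀ (P.map (S 0)) (P.map (Z 0)) := by
  have hm : Measurable fun ω (n : ℕ) => Z (t + n) ω :=
    measurable_pi_lambda _ fun n => hZ.measurable _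
  have hi := (indepFun_iff_map_prod_eq_prod_map_map (h.measurable t).aemeasurable
    hm.aemeasurable).1 (h.nonanticipative t)
  rw [forwardLaw, ← hZ.map_futurePath t, ← h.map_eq t, ← hi, Measure.map_map]
  · refine Measure.map_congr ?_
    filter_upwards [h.eq_forwardPath t] with ω hω
    funext n
    simp [futurePath, pairPath, hω n]
  · exact measurable_pi_lambda _ fun n =>
      (measurable_forwardPath (M.measurable_volStep θ₀) n).prodMk (by fun_prop)
  · exact (h.measurable t).prodMk hm

lemma IsSolution.map_pairPath_eq [IsProbabilityMeasure P] (h : M.IsSolution θ₀ P Z S)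
    (hZ : IsInnovation P Z) {Ω' : Type*} [MeasurableSpace Ω'] {P' : Measure Ω'}
    [IsProbabilityMeasure P'] {Z' S' : ℤ → Ω' → ℝ} (h' : M.IsSolution θ₀ P' Z' S')
    (hZ' : IsInnovation P' Z') (hS0 : P'.map (S' 0) = P.map (S 0))
    (hZ0 : P'.map (Z' 0) = P.map (Z 0)) :
    P'.map (pairPath S' Z') = P.map (pairPath S Z) := by
  have hm := h.measurable_pairPath hZ
  have hm' := h'.measurable_pairPath hZ'
  have := Measure.isProbabilityMeasure_map hm.aemeasurable (μ := P)
  have := Measure.isProbabilityMeasure_map hm'.aemeasurable (μ := P')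
  refine measure_ext_of_map_futurePath fun t => ?_
  rw [Measure.map_map (by fun_prop) hm, Measure.map_map (by fun_prop) hm']
  exact (h'.map_futurePath hZ' t).trans (by rw [hS0, hZ0]; exact (h.map_futurePath hZ t).symm)

/-- The law of the path of `(σ_t ^ 2, Z_t)` is shift invariant. -/
lemma IsSolution.measurePreserving_pathShift [IsProbabilityMeasure P] (h : M.IsSolution θ₀ P Z S)
    (hZ : IsInnovation P Z) (k : ℤ) :
    MeasurePreserving (pathShift k) (P.map (pairPath S Z)) (P.map (pairPath S Z)) := by
  have hm := h.measurable_pairPath hZ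
  have := Measure.isProbabilityMeasure_map hm.aemeasurable (μ := P)
  refine ⟨measurable_pathShift k, ?_⟩
  have hms : Measurable (pathShift k ∘ pairPath S Z) := (measurable_pathShift k).comp hm
  rw [Measure.map_map (by fun_prop) hm]
  have := Measure.isProbabilityMeasure_map hms.aemeasurable (μ := P)
  refine measure_ext_of_map_futurePath fun t => ?_
  rw [Measure.map_map (by fun_prop) hm, Measure.map_map (by fun_prop) hms]
  have e1 := h.map_futurePath hZ t
  have e2 := h.map_futurePath hZ (t + k)
  simp only [Function.comp_def, futurePath_pathShift]
  rw [e1, e2]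

/-- The window of the last `N` values of a past, padded with zeros. -/
def padWindow (N : ℕ) (y : ℕ → ℝ × ℝ) : ℕ → ℝ × ℝ := fun n => if n < N then y n else 0

lemma measurable_padWindow (N : ℕ) : Measurable (padWindow N) :=
  measurable_pi_lambda _ fun n => by
    by_cases hn : n < N
    · simpa [padWindow, hn] using measurable_pi_apply n
    · simp [padWindow, hn]

/-- Non-anticipation concerns `σ_t²` alone; this upgrades it to finite windows of the past. One
starts a step earlier, splits `Z_{t-1}` off the future, and observes that `σ_t²` and the longer
window are functions of `σ_{t-1}²`, the shorter window and `Z_{t-1}`. -/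
lemma IsSolution.indepFun_padWindow [IsProbabilityMeasure P] (h : M.IsSolution θ₀ P Z S)
    (hZ : IsInnovation P Z) (N : ℕ) (t : ℤ) :
    IndepFun (fun ω => (S t ω, padWindow N (pastPath t (pairPath S Z ω))))
      (fun ω => futurePath t (fun s => Z s ω)) P := by
  have hZm : Measurable fun ω (s : ℤ) => Z s ω := measurable_pi_lambda _ hZ.measurable
  have hY := h.measurable_pairPath hZ
  induction N generalizing t with
  | zero =>
    have h1 := (h.nonanticipative t).comp
      (φ := fun s => (s, fun _ : ℕ => (0 : ℝ × ℝ))) (by fun_prop) measurable_id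
    have h0 : ∀ y, padWindow 0 y = fun _ => 0 := fun y => by funext n; simp [padWindow]
    simp only [h0]
    exact h1
  | succ N ih =>
    have hW : Measurable fun ω => (S (t - 1) ω, padWindow N (pastPath (t - 1) (pairPath S Z ω))) :=
      (h.measurable _).prodMk ((measurable_padWindow N).comp ((measurable_pastPath _).comp hY))
    have hF : Measurable fun ω => futurePath t (fun s => Z s ω) :=
      (measurable_futurePath t).comp hZm
    have h1 := (ih (t - 1)).comp measurable_id
      (ψ := fun z : ℕ → ℝ => (z 0, fun n => z (n + 1))) (by fun_prop)
    have hsplit : ((fun z : ℕ → ℝ => (z 0, fun n => z (n + 1))) ∘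
        fun ω => futurePath (t - 1) (fun s => Z s ω)) =
        fun ω => (Z (t - 1) ω, futurePath t (fun s => Z s ω)) := by
      funext ω
      simp only [Function.comp, futurePath, Prod.mk.injEq]
      refine ⟨by simp, funext fun n => ?_⟩
      congr 1; push_cast; ring
    rw [hsplit] at h1
    have h2 := hZ.indep.indepFun_futurePath hZ.measurable (t - 1)
    rw [sub_add_cancel] at h2
    have h3 := h1.prodMk_left_of_indepFun hW (hZ.measurable _) hF h2
    let G : (ℝ × (ℕ → ℝ × ℝ)) × ℝ → ℝ × (ℕ → ℝ × ℝ) := fun p =>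
      (M.volStep θ₀ p.1.1 p.2, fun n => Nat.casesOn n (p.1.1, p.2) fun k => p.1.2 k)
    have hG : Measurable G := by
      refine ((M.measurable_volStep θ₀).comp (by fun_prop :
        Measurable fun p : (ℝ × (ℕ → ℝ × ℝ)) × ℝ => (p.1.1, p.2))).prodMk
        (measurable_pi_lambda _ fun n => ?_)
      cases n with
      | zero => exact (by fun_prop : Measurable fun p : (ℝ × (ℕ → ℝ × ℝ)) × ℝ => (p.1.1, p.2))
      | succ k => exact (by fun_prop : Measurable fun p : (ℝ × (ℕ → ℝ × ℝ)) × ℝ => p.1.2 k)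
    refine (h3.comp hG measurable_id).congr ?_ (ae_of_all _ fun ω => rfl)
    filter_upwards [h.step (t - 1)] with ω hω
    rw [sub_add_cancel] at hω
    simp only [Function.comp, G, hω, Prod.mk.injEq, true_and]
    funext n
    cases n with
    | zero => simp [padWindow, pastPath, pairPath]
    | succ k =>
      have e : t - 1 - 1 - (k : ℤ) = t - 1 - ((k : ℤ) + 1) := by ring
      simp [padWindow, pastPath, e]

/-- The present volatility and the whole past are independent of the present and future
innovations. -/
lemma IsSolution.indepFun_past_future [IsProbabilityMeasure P] (h : M.IsSolution θ₀ P Z S)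
    (hZ : IsInnovation P Z) (t : ℤ) :
    IndepFun (fun ω => (S t ω, pastPath t (pairPath S Z ω)))
      (fun ω => futurePath t (fun s => Z s ω)) P := by
  have hZm : Measurable fun ω (s : ℤ) => Z s ω := measurable_pi_lambda _ hZ.measurable
  have hY := h.measurable_pairPath hZ
  let W : ℕ → Ω → ℝ × (ℕ → ℝ × ℝ) := fun N ω => (S t ω, padWindow N (pastPath t (pairPath S Z ω)))
  have hW : ∀ N, Measurable (W N) := fun N =>
    (h.measurable _).prodMk ((measurable_padWindow N).comp ((measurable_pastPath _).comp hY))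
  have hF : Measurable fun ω => futurePath t (fun s => Z s ω) :=
    (measurable_futurePath t).comp hZm
  -- The windows generate an increasing family of σ-algebras, so independence passes to their
  -- supremum; coordinate `n` of the past is visible in the window of length `n + 1`.
  have hmono : Monotone fun N => MeasurableSpace.comap (W N) inferInstance := by
    intro N N' hN
    have : W N = (fun p : ℝ × (ℕ → ℝ × ℝ) => (p.1, padWindow N p.2)) ∘ W N' := by
      funext ω
      simp only [W, Function.comp, Prod.mk.injEq, true_and]
      funext n
      by_cases hn : n < N
      · simp [padWindow, hn, hn.trans_le hN]
      · simp [padWindow, hn]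
    simp only
    rw [this, ← MeasurableSpace.comap_comp]
    refine MeasurableSpace.comap_mono (Measurable.comap_le ?_)
    exact measurable_fst.prodMk ((measurable_padWindow N).comp measurable_snd)
  have hi := indep_iSup_of_monotone (fun N => h.indepFun_padWindow hZ N t)
    (fun N => (hW N).comap_le) hF.comap_le hmono
  refine indep_of_indep_of_le_left hi ?_
  rw [← measurable_iff_comap_le]
  have hWN : ∀ N, @Measurable _ _ (⨆ N, MeasurableSpace.comap (W N) inferInstance) _ (W N) :=
    fun N => measurable_iff_comap_le.2 (le_iSup (fun N => MeasurableSpace.comap (W N) _) N)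
  refine @Measurable.prodMk _ _ _ _ _ (_) _ _ (measurable_fst.comp (hWN 0))
    (@measurable_pi_lambda _ _ _ (_) _ _ fun n => ?_)
  have h1 := (measurable_pi_apply n).comp (measurable_snd.comp (hWN (n + 1)))
  simpa [W, Function.comp_def, padWindow] using h1

end VolatilityModel

/-! ### Conditioning on invariant events, and ergodicity. -/

lemma IsInnovation.of_map_eq {Ω Ω' : Type*} [MeasurableSpace Ω] [MeasurableSpace Ω']
    {P : Measure Ω} {P' : Measure Ω'} [IsProbabilityMeasure P] [IsProbabilityMeasure P']
    {Z : ℤ → Ω → ℝ} {Z' : ℤ → Ω' → ℝ} (hZ : IsInnovation P Z) (hm : ∀ t, Measurable (Z' t))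
    (hlaw : P'.map (fun ω t => Z' t ω) = P.map (fun ω t => Z t ω)) : IsInnovation P' Z' := by
  have hid : IdentDistrib (fun ω t => Z' t ω) (fun ω t => Z t ω) P' P :=
    ⟨(measurable_pi_lambda _ hm).aemeasurable, (measurable_pi_lambda _ hZ.measurable).aemeasurable,
      hlaw⟩
  have hidt : ∀ t, IdentDistrib (Z' t) (Z t) P' P := fun t => hid.comp (measurable_pi_apply t)
  refine ⟨hm, ?_, fun t => ((hidt t).trans (hZ.identDistrib t)).trans (hidt 0).symm,
    (hidt 0).memLp_iff.2 hZ.memLp, (hidt 0).integral_eq.trans hZ.mean, ?_⟩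
  · rw [iIndepFun_iff_map_fun_eq_infinitePi_map hm, hlaw,
      hZ.indep.map_fun_eq_infinitePi_map hZ.measurable]
    congr 1; funext t; exact (hidt t).map_eq.symm
  · exact ((hidt 0).comp (u := fun x => x ^ 2) (by fun_prop)).integral_eq.trans hZ.variance

/-- For a shift-invariant law on two-sided sequences, every shift-invariant event is approximated by
events which depend only on the past before a given time. -/
lemma exists_past_approx {α : Type*} [MeasurableSpace α] {μ : Measure (ℤ → α)}
    [IsProbabilityMeasure μ] (hμ : ∀ k, MeasurePreserving (pathShift k) μ μ) {B : Set (ℤ → α)}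
    (hBm : MeasurableSet B) (hB : pathShift 1 ⁻¹' B = B) (t : ℤ) {ε : ℝ} (hε : 0 < ε) :
    ∃ D : Set (ℕ → α), MeasurableSet D ∧ μ.real (symmDiff B (pastPath t ⁻¹' D)) < ε := by
  have hd := Measure.MeasureDense.of_generateFrom_isSetAlgebra_finite μ
    (isSetAlgebra_measurableCylinders (α := fun _ : ℤ => α)) generateFrom_measurableCylinders.symm
  obtain ⟨B₀, hB₀, hlt⟩ := hd.approx B hBm (measure_ne_top _ _) ε hε
  obtain ⟨I, V, hV, rfl⟩ := (mem_measurableCylinders B₀).1 hB₀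
  obtain ⟨b, hb⟩ := I.bddAbove
  -- The cylinder sees times up to `b`; after this shift it sees times up to `t - 1` only.
  set k : ℤ := t - 1 - b with hk
  let r : (ℕ → α) → (I → α) := fun z i => z (b - (i : ℤ)).toNat
  have hr : Measurable r := by fun_prop
  refine ⟨r ⁻¹' V, hr hV, ?_⟩
  have heq : pastPath t ⁻¹' (r ⁻¹' V) = pathShift k ⁻¹' cylinder I V := by
    ext y
    simp only [Set.mem_preimage, mem_cylinder]
    have : r (pastPath t y) = I.restrict (pathShift k y) := by
      funext i
      have hi : (i : ℤ) ≤ b := hb i.2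
      simp only [r, pastPath, pathShift, Finset.restrict]
      congr 1; omega
    rw [this]
  have hsd : symmDiff B (pastPath t ⁻¹' (r ⁻¹' V)) =
      pathShift k ⁻¹' symmDiff B (cylinder I V) := by
    rw [heq]
    conv_lhs => rw [← preimage_pathShift_of_invariant hB k]
    rfl
  rw [hsd, Measure.real, (hμ k).measure_preimage
    ((hBm.symmDiff (MeasurableSet.cylinder I hV)).nullMeasurableSet)]
  exact (ENNReal.toReal_lt_toReal (measure_ne_top _ _) ENNReal.ofReal_ne_top).2 hlt |>.trans_eq
    (ENNReal.toReal_ofReal hε.le)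

namespace VolatilityModel

variable {E : Type*} {Ω : Type*} [MeasurableSpace Ω] {P : Measure Ω} {M : VolatilityModel E}
  {θ₀ : E} {Z S : ℤ → Ω → ℝ}

/-- A shift-invariant event is independent of the innovations from time `t` on, jointly with
the volatility at time `t`. -/
lemma IsSolution.measure_invariant_inter [IsProbabilityMeasure P] (h : M.IsSolution θ₀ P Z S)
    (hZ : IsInnovation P Z) {B : Set (ℤ → ℝ × ℝ)} (hBm : MeasurableSet B)
    (hB : pathShift 1 ⁻¹' B = B) (t : ℤ) {A : Set ℝ} (hA : MeasurableSet A) {C : Set (ℕ → ℝ)}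
    (hC : MeasurableSet C) :
    (P.map (pairPath S Z)) (B ∩ ({y | (y t).1 ∈ A} ∩ {y | futurePath t (fun s => (y s).2) ∈ C})) =
      (P.map (pairPath S Z)) (B ∩ {y | (y t).1 ∈ A}) *
        (P.map (pairPath S Z)) {y | futurePath t (fun s => (y s).2) ∈ C} := by
  have hY := h.measurable_pairPath hZ
  have hprob := Measure.isProbabilityMeasure_map hY.aemeasurable (μ := P)
  set μ := P.map (pairPath S Z) with hμ
  set A' : Set (ℤ → ℝ × ℝ) := {y | (y t).1 ∈ A} with hA'
  set C' : Set (ℤ → ℝ × ℝ) := {y | futurePath t (fun s => (y s).2) ∈ C} with hC'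
  have hA'm : MeasurableSet A' := (by fun_prop : Measurable fun y : ℤ → ℝ × ℝ => (y t).1) hA
  have hfm : Measurable fun y : ℤ → ℝ × ℝ => futurePath t (fun s => (y s).2) := by
    unfold futurePath; fun_prop
  have hC'm : MeasurableSet C' := hfm hC
  have hindep : ∀ D : Set (ℕ → ℝ × ℝ), MeasurableSet D →
      μ.real (pastPath t ⁻¹' D ∩ (A' ∩ C')) = μ.real (pastPath t ⁻¹' D ∩ A') * μ.real C' := by
    intro D hD
    have hDm : MeasurableSet (pastPath t ⁻¹' D) := measurable_pastPath t hD
    have h1 := indepFun_iff_measure_inter_preimage_eq_mul.1 (h.indepFun_past_future hZ t)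
      (A ×ˢ D) C (hA.prod hD) hC
    have h2 : μ (pastPath t ⁻¹' D ∩ (A' ∩ C')) = μ (pastPath t ⁻¹' D ∩ A') * μ C' := by
      rw [hμ, Measure.map_apply hY (hDm.inter (hA'm.inter hC'm)),
        Measure.map_apply hY (hDm.inter hA'm), Measure.map_apply hY hC'm]
      convert h1 using 2
      · ext ω
        simp only [hA', hC', Set.mem_preimage, Set.mem_inter_iff, Set.mem_ofPred_eq, Set.mem_prod,
          pairPath]
        tauto
      · congr 1
        ext ω
        simp only [hA', Set.mem_preimage, Set.mem_inter_iff, Set.mem_ofPred_eq, Set.mem_prod,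
          pairPath]
        tauto
      · rfl
    simp only [Measure.real, h2, ENNReal.toReal_mul]
  have hdiff : ∀ D : Set (ℤ → ℝ × ℝ), MeasurableSet D → ∀ F : Set (ℤ → ℝ × ℝ), MeasurableSet F →
      |μ.real (B ∩ F) - μ.real (D ∩ F)| ≤ μ.real (symmDiff B D) := by
    intro D hD F hF
    refine (abs_measureReal_sub_le_measureReal_symmDiff' (hBm.inter hF).nullMeasurableSet
      (hD.inter hF).nullMeasurableSet ?_ ?_).trans
      (measureReal_mono ?_ (measure_ne_top _ _))
    · exact measure_ne_top _ _
    · exact measure_ne_top _ _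
    · intro y hy
      simp only [Set.mem_symmDiff, Set.mem_inter_iff] at hy ⊢
      tauto
  have hreal : μ.real (B ∩ (A' ∩ C')) = μ.real (B ∩ A') * μ.real C' := by
    -- Replacing the invariant event by a past event costs `ε / 2` on each side, the right-hand
    -- error being multiplied by a probability.
    refine eq_of_abs_sub_le_all fun ε hε => ?_
    obtain ⟨D, hD, hlt⟩ := exists_past_approx (h.measurePreserving_pathShift hZ) hBm hB t
      (half_pos hε)
    have hDm : MeasurableSet (pastPath t ⁻¹' D) := measurable_pastPath t hD
    have h1 := (hdiff _ hDm _ (hA'm.inter hC'm)).trans hlt.le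
    have h2 := (hdiff _ hDm _ hA'm).trans hlt.le
    rw [hindep D hD] at h1
    have h3 : 0 ≤ μ.real C' := measureReal_nonneg
    have h4 : μ.real C' ≤ 1 := measureReal_le_one
    rw [abs_le] at h1 h2 ⊢
    constructor <;> nlinarith
  have := congrArg ENNReal.ofReal hreal
  rwa [ENNReal.ofReal_mul measureReal_nonneg, ofReal_measureReal, ofReal_measureReal,
    ofReal_measureReal] at this

/-- The law of a solution, conditioned on a shift-invariant event, is the law of a solution driven
by innovations with the same law. -/
lemma IsSolution.cond [IsProbabilityMeasure P] (h : M.IsSolution θ₀ P Z S)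
    (hZ : IsInnovation P Z) {B : Set (ℤ → ℝ × ℝ)} (hBm : MeasurableSet B)
    (hB : pathShift 1 ⁻¹' B = B) (hB0 : (P.map (pairPath S Z)) B ≠ 0) :
    IsInnovation (ProbabilityTheory.cond (P.map (pairPath S Z)) B)
        (fun t (y : ℤ → ℝ × ℝ) => (y t).2) ∧
      (ProbabilityTheory.cond (P.map (pairPath S Z)) B).map (fun y => (y 0).2) = P.map (Z 0) ∧
      M.IsSolution θ₀ (ProbabilityTheory.cond (P.map (pairPath S Z)) B)
        (fun t (y : ℤ → ℝ × ℝ) => (y t).2) (fun t (y : ℤ → ℝ × ℝ) => (y t).1) := by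
  have hY := h.measurable_pairPath hZ
  have hprob := Measure.isProbabilityMeasure_map hY.aemeasurable (μ := P)
  have hinv := fun t A hA C hC => h.measure_invariant_inter hZ hBm hB t (A := A) hA (C := C) hC
  have hpres := h.measurePreserving_pathShift hZ
  set μ := P.map (pairPath S Z) with hμ
  have hprob' : IsProbabilityMeasure (ProbabilityTheory.cond μ B) := cond_isProbabilityMeasure hB0
  set ν := ProbabilityTheory.cond μ B with hν
  have hac : ν ≪ μ := cond_absolutelyContinuous
  have hzm : Measurable fun (y : ℤ → ℝ × ℝ) s => (y s).2 := by fun_prop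
  have hsm : ∀ t, Measurable fun y : ℤ → ℝ × ℝ => (y t).1 := fun t => by fun_prop
  have hfut : ∀ t A, MeasurableSet A → ∀ C, MeasurableSet C →
      ν ({y | (y t).1 ∈ A} ∩ {y | futurePath t (fun s => (y s).2) ∈ C}) =
        ν {y | (y t).1 ∈ A} * μ {y | futurePath t (fun s => (y s).2) ∈ C} := by
    intro t A hA C hC
    rw [hν, cond_apply hBm, cond_apply hBm, hinv t A hA C hC, mul_assoc]
  have hfut1 : ∀ t C, MeasurableSet C → ν {y | futurePath t (fun s => (y s).2) ∈ C} =
      μ {y | futurePath t (fun s => (y s).2) ∈ C} := by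
    intro t C hC
    simpa using hfut t Set.univ MeasurableSet.univ C hC
  have hlawZ : ν.map (fun y s => (y s).2) = P.map (fun ω s => Z s ω) := by
    have e : P.map (fun ω s => Z s ω) = μ.map (fun y s => (y s).2) := by
      rw [hμ, Measure.map_map hzm hY]; rfl
    rw [e]
    have := Measure.isProbabilityMeasure_map hzm.aemeasurable (μ := μ)
    have := Measure.isProbabilityMeasure_map hzm.aemeasurable (μ := ν)
    refine measure_ext_of_map_futurePath fun t => ?_
    rw [Measure.map_map (measurable_futurePath t) hzm,
      Measure.map_map (measurable_futurePath t) hzm]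
    ext C hC
    rw [Measure.map_apply ((measurable_futurePath t).comp hzm) hC,
      Measure.map_apply ((measurable_futurePath t).comp hzm) hC]
    exact hfut1 t C hC
  refine ⟨hZ.of_map_eq (fun t => by fun_prop) hlawZ, ?_, ?_⟩
  · have := congrArg (Measure.map fun z : ℤ → ℝ => z 0) hlawZ
    rwa [Measure.map_map (by fun_prop) hzm, Measure.map_map (by fun_prop)
      (measurable_pi_lambda _ hZ.measurable)] at this
  refine ⟨hsm, fun t => hac.ae_le ?_, fun t => hac.ae_le ?_, fun k => ?_, fun t => ?_, ?_⟩
  · exact (ae_map_iff hY.aemeasurable (hsm t M.measurableSet_source)).2 (h.mem_source t)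
  · refine (ae_map_iff hY.aemeasurable ?_).2 (h.recursion t)
    · refine measurableSet_eq_fun (M.measurable_h.comp (hsm _)) ((M.measurable_ψ θ₀).comp
        (f := fun y : ℤ → ℝ × ℝ => ((y t).2, M.h (y t).1)) ?_)
      exact (by fun_prop : Measurable fun y : ℤ → ℝ × ℝ => (y t).2).prodMk
        (M.measurable_h.comp (hsm t))
  · have hpν : MeasurePreserving (pathShift k) ν ν := by
      refine ⟨measurable_pathShift k, Measure.ext fun F hF => ?_⟩
      rw [Measure.map_apply (measurable_pathShift k) hF, hν, cond_apply hBm, cond_apply hBm]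
      congr 1
      conv_lhs => rw [← preimage_pathShift_of_invariant hB k]
      rw [← Set.preimage_inter]
      exact (hpres k).measure_preimage (hBm.inter hF).nullMeasurableSet
    have hm1 : Measurable fun (y : ℤ → ℝ × ℝ) t => (y t).1 := by fun_prop
    refine ⟨(hm1.comp (measurable_pathShift k)).aemeasurable, hm1.aemeasurable, ?_⟩
    conv_rhs => rw [← hpν.map_eq]
    rw [Measure.map_map hm1 (measurable_pathShift k)]
    rfl
  · rw [indepFun_iff_measure_inter_preimage_eq_mul]
    intro A C hA hC
    refine (hfut t A hA C hC).trans ?_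
    rw [← hfut1 t C hC]
    rfl
  · have h1 : Integrable (fun y : ℤ → ℝ × ℝ => Real.posLog (y 0).1) μ := by
      rw [hμ, integrable_map_measure ?_ hY.aemeasurable]
      · exact h.log_moment
      · exact ((measurable_const.max (Real.measurable_log.comp (hsm 0)))).aestronglyMeasurable
    exact h1.restrict.smul_measure (ENNReal.inv_ne_top.2 hB0)

/-- Under condition (ST) the shift is ergodic for the law of `(σ_t ^ 2, Z_t)`. -/
theorem ST.ergodic [IsProbabilityMeasure P] (h : M.ST θ₀ P Z S) (hZ : IsInnovation P Z) :
    Ergodic (pathShift 1) (P.map (pairPath S Z)) := by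
  have hsol := h.isSolution
  have hY := hsol.measurable_pairPath hZ
  have hprob := Measure.isProbabilityMeasure_map hY.aemeasurable (μ := P)
  refine ⟨hsol.measurePreserving_pathShift hZ 1, ⟨fun {B} hBm hB => ?_⟩⟩
  rw [eventuallyConst_set']
  by_cases hB0 : (P.map (pairPath S Z)) B = 0
  · exact Or.inl (ae_eq_empty.2 hB0)
  right
  obtain ⟨hinn, hlaw, hcond⟩ := hsol.cond hZ hBm hB hB0
  have hprob' : IsProbabilityMeasure (ProbabilityTheory.cond (P.map (pairPath S Z)) B) :=
    cond_isProbabilityMeasure hB0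
  -- Uniqueness is applied on the path space itself, under the conditioned law. Only the resulting
  -- marginal of `σ_0²` is used: with the innovation law it determines the joint law of the pair.
  have hS := h.unique _ _ _ _ hinn
    ⟨(hinn.measurable 0).aemeasurable, (hZ.measurable 0).aemeasurable, hlaw⟩ hcond
  have hS0 := (hS.comp (measurable_pi_apply 0)).map_eq
  have hpair := hsol.map_pairPath_eq hZ hcond hinn hS0 hlaw
  have hid : pairPath (fun t (y : ℤ → ℝ × ℝ) => (y t).1) (fun t (y : ℤ → ℝ × ℝ) => (y t).2) = id :=
    rfl
  rw [hid, Measure.map_id] at hpair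
  rw [ae_eq_univ, ← hpair, cond_apply hBm, Set.inter_compl_self, measure_empty, mul_zero]

/-- Along almost every path of a model satisfying (ST), averages of functionals of the shifted path
converge to their expectations. -/
theorem ST.ae_tendsto_average [IsProbabilityMeasure P] (h : M.ST θ₀ P Z S) (hZ : IsInnovation P Z)
    {f : (ℤ → ℝ × ℝ) → ℝ} (hfm : Measurable f) (hf : Integrable (fun ω => f (pairPath S Z ω)) P) :
    ∀ᵐ ω ∂P, Tendsto (fun n : ℕ => (∑ t ∈ Finset.Icc 1 n, f (pathShift t (pairPath S Z ω))) / n)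
      atTop (𝓝 (∫ ω, f (pairPath S Z ω) ∂P)) := by
  have hY := h.isSolution.measurable_pairPath hZ
  have hprob := Measure.isProbabilityMeasure_map hY.aemeasurable (μ := P)
  have herg := h.ergodic hZ
  have hfi : Integrable f (P.map (pairPath S Z)) :=
    (integrable_map_measure hfm.aestronglyMeasurable hY.aemeasurable).2 hf
  have hb := herg.ae_tendsto_birkhoffSum_div hfm hfi
  -- Birkhoff sums start at time `0` and the criterion at time `1`, so convergence is taken at the
  -- once-shifted path.
  have hb1 := herg.toMeasurePreserving.quasiMeasurePreserving.ae hb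
  filter_upwards [ae_of_ae_map hY.aemeasurable hb1] with ω hω
  rw [integral_map hY.aemeasurable hfm.aestronglyMeasurable] at hω
  refine hω.congr fun n => ?_
  congr 1
  rw [birkhoffSum, ← Finset.Ico_add_one_right_eq_Icc, Finset.sum_Ico_eq_sum_range]
  refine Finset.sum_congr (by simp) fun t _ => ?_
  rw [iterate_pathShift_one, pathShift_pathShift]
  push_cast
  rw [add_comm]

end VolatilityModel

/-! ### The stationary filter as a functional of past observations. -/

namespace VolatilityModel

variable {E : Type*}

/-- The observations `X_t = σ_t Z_t` as a function of the path of `(σ_t ^ 2, Z_t)`. -/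
noncomputable def obsPath (y : ℤ → ℝ × ℝ) : ℤ → ℝ := fun t => √(y t).1 * (y t).2

@[fun_prop]
lemma measurable_obsPath : Measurable obsPath := by
  unfold obsPath; fun_prop

lemma obsPath_pathShift (k : ℤ) (y : ℤ → ℝ × ℝ) :
    obsPath (pathShift k y) = pathShift k (obsPath y) := rfl

lemma gHat_congr (M : VolatilityModel E) (u : E → ℝ) {x x' : ℤ → ℝ} {t : ℕ}
    (h : ∀ s : ℤ, 0 ≤ s → s < t → x s = x' s) : M.gHat x u t = M.gHat x' u t := by
  induction t with
  | zero => rfl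
  | succ t ih =>
    simp only [gHat]
    rw [ih fun s h0 hs => h s h0 (by push_cast; omega), h t (by omega) (by push_cast; omega)]

lemma measurable_link (M : VolatilityModel E) : Measurable M.link := M.measurable_symm

lemma measurable_φ (M : VolatilityModel E) (θ : E) :
    Measurable (fun p : ℝ × ℝ => M.φ p.1 p.2 θ) :=
  (M.measurable_ψ θ).comp ((measurable_fst.div
    (M.measurable_link.comp measurable_snd).sqrt).prodMk measurable_snd)

lemma measurable_gHat (M : VolatilityModel E) (u : E → ℝ) (t : ℕ) (θ : E) :
    Measurable (fun x : ℤ → ℝ => M.gHat x u t θ) := by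
  induction t with
  | zero => exact measurable_const
  | succ t ih => exact (M.measurable_φ θ).comp ((measurable_pi_apply (t : ℤ)).prodMk ih)

/-- The recursion `ĝ_t` as a function of the past observations, most recent first. -/
noncomputable def gHatPast (M : VolatilityModel E) (u : E → ℝ) (t : ℕ) (θ : E) (p : ℕ → ℝ) : ℝ :=
  M.gHat (fun s => p (t - 1 - s).toNat) u t θ

lemma gHatPast_pastPath (M : VolatilityModel E) (u : E → ℝ) (t : ℕ) (θ : E) (x : ℤ → ℝ) :
    M.gHatPast u t θ (pastPath t x) = M.gHat x u t θ := by
  refine congrFun (M.gHat_congr u fun s h0 hs => ?_) θ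
  simp only [pastPath]
  congr 1; omega

lemma measurable_gHatPast (M : VolatilityModel E) (u : E → ℝ) (t : ℕ) (θ : E) :
    Measurable (M.gHatPast u t θ) :=
  (M.measurable_gHat u t θ).comp (by fun_prop : Measurable fun (p : ℕ → ℝ) (s : ℤ) =>
    p ((t : ℤ) - 1 - s).toNat)

lemma enorm_le_supNorm {Θ : Set E} {θ : E} (hθ : θ ∈ Θ) (f : E → ℝ) : ‖f θ‖ₑ ≤ supNorm Θ f :=
  le_iSup₂ (f := fun θ (_ : θ ∈ Θ) => ‖f θ‖ₑ) θ hθ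

lemma tendsto_of_tendsto_supNorm {Θ : Set E} {θ : E} (hθ : θ ∈ Θ) {f : ℕ → E → ℝ}
    (hf : Tendsto (fun t => supNorm Θ (f t)) atTop (𝓝 0)) :
    Tendsto (fun t => f t θ) atTop (𝓝 0) := by
  rw [tendsto_zero_iff_enorm_tendsto_zero]
  exact tendsto_of_tendsto_of_tendsto_of_le_of_le tendsto_const_nhds hf (fun _ => zero_le)
    fun t => enorm_le_supNorm hθ (f t)

lemma obsPath_pairPath {Ω : Type*} {S Z X : ℤ → Ω → ℝ} (hX : ∀ t ω, X t ω = √(S t ω) * Z t ω)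
    (ω : Ω) : obsPath (pairPath S Z ω) = fun s => X s ω := by
  funext s; simp [obsPath, pairPath, hX]

variable {Ω : Type*} [MeasurableSpace Ω] {P : Measure Ω} {M : VolatilityModel E}
  {θ₀ : E} {Θ : Set E} {K : Set ℝ} {Z S X : ℤ → Ω → ℝ}
  {g : ℤ → E → Ω → ℝ} {u : E → ℝ}

lemma IsSolution.measurable_obs (hS : M.IsSolution θ₀ P Z S) (hZ : IsInnovation P Z)
    (hX : ∀ t ω, X t ω = √(S t ω) * Z t ω) (t : ℤ) : Measurable (X t) := by
  rw [show X t = fun ω => √(S t ω) * Z t ω from funext (hX t)]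
  exact (hS.measurable t).sqrt.mul (hZ.measurable t)

variable [IsProbabilityMeasure P]

/-- In a continuously invertible model, the stationary solution of the inverted recursion at a
given `θ` is a time-invariant measurable function of the past observations. -/
theorem ContinuouslyInvertible.exists_eq_pastPath [TopologicalSpace E]
    (hinv : M.ContinuouslyInvertible Θ K P X g) (hX : ∀ t, Measurable (X t))
    (hu : u ∈ contSpace Θ K) {θ : E} (hθ : θ ∈ Θ) :
    ∃ G : (ℕ → ℝ) → ℝ, Measurable G ∧
      ∀ t : ℤ, ∀ᵐ ω ∂P, g t θ ω = G (pastPath t (fun s => X s ω)) := by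
  have hfil := hinv.isStationaryFilter
  have hXm : Measurable fun ω (s : ℤ) => X s ω := measurable_pi_lambda _ hX
  have hgm : ∀ t, Measurable (g t θ) := fun t => hfil.measurable t θ hθ
  let f : ℕ → Ω → ℝ := fun t ω => M.gHatPast u t θ (pastPath 0 (fun s => X s ω))
  have hgh : ∀ t : ℕ, Measurable fun ω => M.gHat (fun s => X s ω) u t θ := fun t =>
    (M.measurable_gHat u t θ).comp hXm
  have hsnd : Measurable fun (v : ℤ → ℝ × ℝ) s => (v s).2 := by fun_prop
  have hlim : TendstoInMeasure P (fun (t : ℕ) ω => M.gHat (fun s => X s ω) u t θ - g t θ ω) atTop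
      (fun _ => 0) := by
    refine tendstoInMeasure_of_tendsto_ae
      (fun t => ((hgh t).sub (hgm t)).aestronglyMeasurable) ?_
    filter_upwards [hinv.tendsto u hu] with ω hω
    exact tendsto_of_tendsto_supNorm hθ hω
  -- By joint stationarity, the error at time `t` of the recursion started at time `0` has the law
  -- of the error at time `0` of the recursion started at `-t`. Almost sure convergence does not
  -- transfer this way, but convergence in probability does.
  have hf : TendstoInMeasure P f atTop (g 0 θ) := by
    intro ε hε
    refine (hlim ε hε).congr fun t => ?_
    let D : (ℤ → ℝ × ℝ) → ℝ≥0∞ := fun v =>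
      edist (M.gHatPast u t θ (pastPath 0 (fun s => (v s).2))) (v 0).1
    have hD : Measurable D :=
      ((M.measurable_gHatPast u t θ).comp ((measurable_pastPath 0).comp hsnd)).edist (by fun_prop)
    have h1 := ((hfil.stationary θ hθ t).comp hD).measure_mem_eq (measurableSet_Ici (a := ε))
    refine Eq.trans ?_ h1
    congr 1
    ext ω
    have e : pastPath 0 (fun s => X (s + t) ω) = pastPath t (fun s => X s ω) := by
      exact (pastPath_pathShift 0 t (fun s => X s ω)).trans (by rw [zero_add])
    simp only [Set.mem_ofPred_eq, Set.mem_preimage, Function.comp, Set.mem_Ici, D, e,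
      gHatPast_pastPath, zero_add, edist_dist, Real.dist_eq, sub_zero]
  obtain ⟨ns, -, hns⟩ := hf.exists_seq_tendsto_ae
  -- A limsup along the almost surely convergent subsequence gives a functional that is measurable
  -- on all pasts.
  let G : (ℕ → ℝ) → ℝ := fun p => limsup (fun k => M.gHatPast u (ns k) θ p) atTop
  have hG : Measurable G := Measurable.limsup fun k => M.measurable_gHatPast u (ns k) θ
  refine ⟨G, hG, fun t => ?_⟩
  have hset : MeasurableSet {v : ℤ → ℝ × ℝ | (v 0).1 = G (pastPath 0 fun s => (v s).2)} :=
    measurableSet_eq_fun (by fun_prop) (hG.comp ((measurable_pastPath 0).comp hsnd))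
  have h0 : ∀ᵐ ω ∂P, g 0 θ ω = G (pastPath 0 (fun s => X s ω)) := by
    filter_upwards [hns] with ω hω
    exact hω.limsup_eq.symm
  have h1 := (hfil.stationary θ hθ t).symm.ae_snd hset h0
  filter_upwards [h1] with ω hω
  have e : pastPath 0 (fun s => X (s + t) ω) = pastPath t (fun s => X s ω) := by
    exact (pastPath_pathShift 0 t (fun s => X s ω)).trans (by rw [zero_add])
  simpa [e] using hω

/-- Carries almost sure statements about time zero to any other time. -/
lemma IsSolution.ae_pathShift (h : M.IsSolution θ₀ P Z S) (hZ : IsInnovation P Z)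
    {p : (ℤ → ℝ × ℝ) → Prop} (hp : MeasurableSet {y | p y}) (hae : ∀ᵐ ω ∂P, p (pairPath S Z ω))
    (k : ℤ) : ∀ᵐ ω ∂P, p (pathShift k (pairPath S Z ω)) := by
  have hY := (h.measurable_pairPath hZ).aemeasurable (μ := P)
  have h1 : ∀ᵐ y ∂(P.map (pairPath S Z)), p y := (ae_map_iff hY hp).2 hae
  exact ae_of_ae_map hY
    ((h.measurePreserving_pathShift hZ k).quasiMeasurePreserving.ae h1)

lemma IsSolution.integral_pathShift (h : M.IsSolution θ₀ P Z S) (hZ : IsInnovation P Z)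
    {f : (ℤ → ℝ × ℝ) → ℝ} (hf : Measurable f) (k : ℤ) :
    ∫ ω, f (pathShift k (pairPath S Z ω)) ∂P = ∫ ω, f (pairPath S Z ω) ∂P := by
  have hY := h.measurable_pairPath hZ
  rw [← integral_map hY.aemeasurable hf.aestronglyMeasurable,
    ← (h.measurePreserving_pathShift hZ k).map_eq,
    integral_map (measurable_pathShift k).aemeasurable hf.aestronglyMeasurable,
    integral_map hY.aemeasurable
      (f := fun y => f (pathShift k y)) (hf.comp (measurable_pathShift k)).aestronglyMeasurable]

/-- At the true parameter the stationary filter recovers the volatility at all times. -/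
theorem ContinuouslyInvertible.link_eq [TopologicalSpace E]
    (hinv : M.ContinuouslyInvertible Θ K P X g) (hS : M.IsSolution θ₀ P Z S)
    (hZ : IsInnovation P Z) (hX : ∀ t ω, X t ω = √(S t ω) * Z t ω)
    (hu : u ∈ contSpace Θ K) (hθ₀ : θ₀ ∈ Θ) (h0 : ∀ᵐ ω ∂P, M.link (g 0 θ₀ ω) = S 0 ω) (t : ℤ) :
    ∀ᵐ ω ∂P, M.link (g t θ₀ ω) = S t ω := by
  have hXm := hS.measurable_obs hZ hX
  obtain ⟨G, hG, hgG⟩ := hinv.exists_eq_pastPath hXm hu hθ₀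
  have hset : MeasurableSet {y : ℤ → ℝ × ℝ | M.link (G (pastPath 0 (obsPath y))) = (y 0).1} :=
    measurableSet_eq_fun (M.measurable_link.comp
      (hG.comp ((measurable_pastPath 0).comp measurable_obsPath))) (by fun_prop)
  have h1 : ∀ᵐ ω ∂P, M.link (G (pastPath 0 (obsPath (pairPath S Z ω)))) =
      (pairPath S Z ω 0).1 := by
    filter_upwards [h0, hgG 0] with ω h1 h2
    rw [obsPath_pairPath hX, ← h2, h1]; rfl
  filter_upwards [hS.ae_pathShift hZ hset h1 t, hgG t] with ω h2 h3
  rw [obsPath_pathShift, pastPath_pathShift, zero_add, obsPath_pairPath hX, ← h3] at h2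
  simpa [pathShift, pairPath] using h2

/-- If a decreasing sequence of functionals with values in `[0, 1]` has an infimum which vanishes
asymptotically along the shifted path, then their expectations tend to zero. -/
lemma IsSolution.tendsto_integral_zero (h : M.IsSolution θ₀ P Z S) (hZ : IsInnovation P Z)
    {d : ℕ → (ℤ → ℝ × ℝ) → ℝ} (hdm : ∀ k, Measurable (d k)) (hd0 : ∀ k y, 0 ≤ d k y)
    (hd1 : ∀ k y, d k y ≤ 1) (hanti : ∀ y, Antitone fun k => d k y)
    (hlim : ∀ᵐ ω ∂P, Tendsto (fun t : ℕ => ⨅ k, d k (pathShift t (pairPath S Z ω))) atTop (𝓝 0)) :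
    Tendsto (fun k => ∫ ω, d k (pairPath S Z ω) ∂P) atTop (𝓝 0) := by
  have hY := h.measurable_pairPath hZ
  have hbdd : ∀ y, BddBelow (Set.range fun k => d k y) := fun y =>
    ⟨0, by rintro _ ⟨k, rfl⟩; exact hd0 k y⟩
  have hinfm : Measurable fun y => ⨅ k, d k y := Measurable.iInf hdm
  have hinf0 : ∀ y, 0 ≤ ⨅ k, d k y := fun y => le_ciInf fun k => hd0 k y
  have hinf1 : ∀ y, ⨅ k, d k y ≤ 1 := fun y => (ciInf_le (hbdd y) 0).trans (hd1 0 y)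
  have h1 : Tendsto (fun t : ℕ => ∫ ω, ⨅ k, d k (pathShift t (pairPath S Z ω)) ∂P) atTop
      (𝓝 (∫ _, 0 ∂P)) := by
    refine tendsto_integral_of_dominated_convergence (fun _ => 1) (fun t => ?_)
      (integrable_const _) (fun t => ae_of_all _ fun ω => ?_) hlim
    · exact (hinfm.comp ((measurable_pathShift t).comp hY)).aestronglyMeasurable
    · rw [Real.norm_eq_abs, abs_of_nonneg (hinf0 _)]; exact hinf1 _
  -- The expectation of the infimum is constant along time and tends to zero, so it is zero.
  have h2 : ∫ ω, ⨅ k, d k (pairPath S Z ω) ∂P = 0 := by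
    refine tendsto_nhds_unique (tendsto_const_nhds.congr fun t : ℕ => ?_)
      (h1.trans_eq (by simp))
    exact (h.integral_pathShift hZ hinfm t).symm
  rw [← h2]
  refine tendsto_integral_of_dominated_convergence (fun _ => 1) (fun k => ?_)
      (integrable_const _) (fun t => ae_of_all _ fun ω => ?_)
      (ae_of_all _ fun ω => tendsto_atTop_ciInf (hanti _) (hbdd _))
  · exact ((hdm k).comp hY).aestronglyMeasurable
  · rw [Real.norm_eq_abs, abs_of_nonneg (hd0 _ _)]; exact hd1 _ _

end VolatilityModel

/-! ### Averages of null sequences. -/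

lemma sum_Icc_one_eq_sum_range (a : ℕ → ℝ) (n : ℕ) :
    ∑ t ∈ Finset.Icc 1 n, a t = ∑ i ∈ Finset.range n, a (i + 1) := by
  rw [← Finset.Ico_add_one_right_eq_Icc, Finset.sum_Ico_eq_sum_range]
  exact Finset.sum_congr (by simp) fun i _ => by rw [add_comm]

lemma tendsto_average_zero {η : ℕ → ℝ} (hη : Tendsto η atTop (𝓝 0)) :
    Tendsto (fun n : ℕ => (∑ t ∈ Finset.Icc 1 n, η t) / n) atTop (𝓝 0) := by
  refine (hη.comp (tendsto_add_atTop_nat 1)).cesaro.congr fun n => ?_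
  rw [sum_Icc_one_eq_sum_range, div_eq_inv_mul]
  rfl

/-- If nonnegative weights have converging averages, averages of a null sequence with these weights
tend to zero. -/
lemma tendsto_average_mul_zero {a η : ℕ → ℝ} {A : ℝ} (ha : ∀ t, 0 ≤ a t)
    (hA : Tendsto (fun n : ℕ => (∑ t ∈ Finset.Icc 1 n, a t) / n) atTop (𝓝 A))
    (hη : Tendsto η atTop (𝓝 0)) :
    Tendsto (fun n : ℕ => (∑ t ∈ Finset.Icc 1 n, a t * η t) / n) atTop (𝓝 0) := by
  -- Adding `1` to the weights makes their sums diverge even when `A = 0`, as summing a little-o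
  -- relation requires.
  set w : ℕ → ℝ := fun i => a (i + 1) + 1 with hw
  have hw0 : ∀ i, 0 ≤ w i := fun i => by have := ha (i + 1); simp only [hw]; linarith
  have hsum : ∀ n : ℕ, ∑ i ∈ Finset.range n, w i = ∑ t ∈ Finset.Icc 1 n, a t + n := fun n => by
    simp [hw, sum_Icc_one_eq_sum_range, Finset.sum_add_distrib]
  have h1 : (fun i => a (i + 1) * η (i + 1)) =o[atTop] w := by
    rw [Asymptotics.isLittleO_iff]
    intro c hc
    have := (hη.comp (tendsto_add_atTop_nat 1)).abs
    simp only [abs_zero] at this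
    filter_upwards [this.eventually (gt_mem_nhds hc)] with i hi
    rw [Real.norm_eq_abs, Real.norm_eq_abs, abs_mul, abs_of_nonneg (ha _), abs_of_nonneg (hw0 i)]
    have h2 : |η (i + 1)| < c := hi
    have := ha (i + 1)
    simp only [hw]
    nlinarith [abs_nonneg (η (i + 1))]
  have h2 := h1.sum_range hw0 (tendsto_atTop_mono (fun n => by
    rw [hsum]; linarith [Finset.sum_nonneg fun t (_ : t ∈ Finset.Icc 1 n) => ha t])
    tendsto_natCast_atTop_atTop)
  have h3 : (fun n : ℕ => ∑ i ∈ Finset.range n, w i) =O[atTop] (fun n : ℕ => (n : ℝ)) := by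
    refine Asymptotics.isBigO_of_div_tendsto_nhds ?_ (A + 1) ?_
    · filter_upwards [eventually_gt_atTop 0] with n hn h
      exact absurd h (by positivity)
    · refine (hA.add_const 1).congr' ?_
      filter_upwards [eventually_gt_atTop 0] with n hn
      have : (n : ℝ) ≠ 0 := by positivity
      rw [Pi.div_apply, hsum]
      field_simp
  refine (h2.trans_isBigO h3).tendsto_div_nhds_zero.congr fun n => ?_
  rw [sum_Icc_one_eq_sum_range]

/-! ### The criterion at the true parameter and the identification inequality. -/

namespace VolatilityModel

variable {E : Type*} {Ω : Type*} [MeasurableSpace Ω] {P : Measure Ω}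
  {M : VolatilityModel E} {θ₀ : E} {Θ : Set E} {K : Set ℝ}
  {Z S X : ℤ → Ω → ℝ} {g : ℤ → E → Ω → ℝ} {u : E → ℝ}

lemma two_mul_quasiLik (M : VolatilityModel E) (x : ℤ → ℝ) (u : E → ℝ) (n : ℕ) (θ : E) :
    2 * M.quasiLik x u n θ = (∑ t ∈ Finset.Icc 1 n,
      (x t ^ 2 / M.link (M.gHat x u t θ) + Real.log (M.link (M.gHat x u t θ)))) / n := by
  rw [quasiLik, ← mul_div_assoc, mul_div_mul_left _ _ two_ne_zero]

lemma IsSolution.ae_pos (h : M.IsSolution θ₀ P Z S) (t : ℤ) : ∀ᵐ ω ∂P, 0 < S t ω := by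
  filter_upwards [h.mem_source t] with ω hω using M.source_pos hω

lemma _root_.IsInnovation.integrable_sq (hZ : IsInnovation P Z) :
    Integrable (fun ω => Z 0 ω ^ 2) P := hZ.memLp.integrable_sq

variable [TopologicalSpace E]

lemma PreservesContSpace.ae_gHat_mem (hcont : M.PreservesContSpace Θ K P X)
    (hu : u ∈ contSpace Θ K) :
    ∀ᵐ ω ∂P, ∀ t, M.gHat (fun s => X s ω) u t ∈ contSpace Θ K := by
  filter_upwards [ae_all_iff.2 hcont] with ω hω t
  induction t with
  | zero => exact hu
  | succ t ih => exact hω t _ ih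

variable [IsProbabilityMeasure P]

/-- The volatility at time zero has an integrable logarithm, since it is bounded away from zero. -/
lemma IsSolution.integrable_log (hS : M.IsSolution θ₀ P Z S)
    (hinv : M.ContinuouslyInvertible Θ K P X g) (hLB : M.LB K) (hθ₀ : θ₀ ∈ Θ)
    (h0 : ∀ᵐ ω ∂P, M.link (g 0 θ₀ ω) = S 0 ω) : Integrable (fun ω => Real.log (S 0 ω)) P := by
  obtain ⟨-, -, m, hm, hmK⟩ := hLB
  refine (hS.log_moment.add (integrable_const |Real.log m|)).mono'
    (Real.measurable_log.comp (hS.measurable 0)).aestronglyMeasurable ?_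
  filter_upwards [h0, hinv.isStationaryFilter.mem 0 θ₀ hθ₀] with ω h1 h2
  have h3 : Real.log m ≤ Real.log (S 0 ω) := Real.log_le_log hm (h1 ▸ hmK _ h2)
  have h4 : Real.log (S 0 ω) ≤ Real.posLog (S 0 ω) := le_max_right _ _
  have h5 : 0 ≤ Real.posLog (S 0 ω) := le_max_left _ _
  rw [Real.norm_eq_abs, Pi.add_apply, abs_le]
  constructor <;> linarith [neg_abs_le (Real.log m), abs_nonneg (Real.log m)]

/-- At the true parameter the quasi-likelihood is asymptotically at most its expectation. -/
theorem ContinuouslyInvertible.eventually_quasiLik_lt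
    (hinv : M.ContinuouslyInvertible Θ K P X g) (hcont : M.PreservesContSpace Θ K P X)
    (hST : M.ST θ₀ P Z S) (hZ : IsInnovation P Z) (hX : ∀ t ω, X t ω = √(S t ω) * Z t ω)
    (hLB : M.LB K) (hu : u ∈ contSpace Θ K) (hθ₀ : θ₀ ∈ Θ)
    (h0 : ∀ᵐ ω ∂P, M.link (g 0 θ₀ ω) = S 0 ω) {c : ℝ} (hc : 1 + ∫ ω, Real.log (S 0 ω) ∂P < c) :
    ∀ᵐ ω ∂P, ∀ᶠ n in atTop, 2 * M.quasiLik (fun s => X s ω) u n θ₀ < c := by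
  have hS := hST.isSolution
  have hlog := hS.integrable_log hinv hLB hθ₀ h0
  obtain ⟨-, ⟨C, hC⟩, m, hm, hmK⟩ := hLB
  have hav1 := hST.ae_tendsto_average hZ (f := fun y => (y 0).2 ^ 2) (by fun_prop)
    hZ.integrable_sq
  have hav2 := hST.ae_tendsto_average hZ (f := fun y => Real.log (y 0).1) (by fun_prop) hlog
  filter_upwards [hav1, hav2, hinv.tendsto u hu, hcont.ae_gHat_mem hu,
    ae_all_iff.2 fun t => hinv.link_eq hS hZ hX hu hθ₀ h0 t,
    ae_all_iff.2 fun t => hinv.isStationaryFilter.mem t θ₀ hθ₀] with ω h1 h2 h3 h4 h5 h6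
  simp only [pairPath, pathShift, zero_add, hZ.variance] at h1 h2
  have hd := tendsto_of_tendsto_supNorm hθ₀ h3
  set d : ℕ → ℝ := fun t => M.gHat (fun s => X s ω) u t θ₀ - g t θ₀ ω with hd_def
  have hCd : Tendsto (fun t => C * |d t|) atTop (𝓝 0) := by
    simpa using hd.abs.const_mul (C : ℝ)
  have hexp : Tendsto (fun t => Real.exp (C * |d t|) - 1) atTop (𝓝 0) := by
    have := (Real.continuous_exp.tendsto 0).comp hCd
    simpa using this.sub_const 1
  have h7 := tendsto_average_mul_zero (fun t => sq_nonneg (Z t ω)) h1 hexp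
  have h8 := tendsto_average_zero hCd
  have hlim := ((h1.add h2).add h7).add h8
  simp only [add_zero] at hlim
  filter_upwards [hlim.eventually (gt_mem_nhds hc)] with n hn
  refine lt_of_le_of_lt ?_ hn
  rw [two_mul_quasiLik, ← add_div, ← add_div, ← add_div, ← Finset.sum_add_distrib,
    ← Finset.sum_add_distrib, ← Finset.sum_add_distrib]
  refine div_le_div_of_nonneg_right (Finset.sum_le_sum fun t _ => ?_) (Nat.cast_nonneg n)
  have hgm := (h4 t).2 hθ₀
  have hpos : 0 < S t ω := by rw [← h5 t]; exact hm.trans_le (hmK _ (h6 t))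
  have hpos' := hm.trans_le (hmK _ hgm)
  have hlip := hC.dist_le_mul _ hgm _ (h6 t)
  rw [Real.dist_eq, Real.dist_eq, abs_le, h5 t] at hlip
  have hX2 : X t ω ^ 2 = S t ω * Z t ω ^ 2 := by rw [hX, mul_pow, Real.sq_sqrt hpos.le]
  -- The Lipschitz bound on `log ℓ` is exponentiated, so `X_t² / ℓ(ĝ_t)` is at most `Z_t²` plus
  -- `Z_t²` times a null sequence, and no moment of `σ_t²` is needed.
  have hratio : S t ω / M.link (M.gHat (fun s => X s ω) u t θ₀) ≤ Real.exp (C * |d t|) := by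
    rw [← Real.log_le_iff_le_exp (div_pos hpos hpos'), Real.log_div hpos.ne' hpos'.ne']
    simp only [hd_def]; linarith [hlip.1]
  have hmul := mul_le_mul_of_nonneg_right hratio (sq_nonneg (Z t ω))
  rw [hX2]
  have e : S t ω * Z t ω ^ 2 / M.link (M.gHat (fun s => X s ω) u t θ₀) =
    S t ω / M.link (M.gHat (fun s => X s ω) u t θ₀) * Z t ω ^ 2 := by ring
  rw [e]
  have hlip2 : Real.log (M.link (M.gHat (fun s => X s ω) u t θ₀)) - Real.log (S t ω) ≤
    C * |d t| := hlip.2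
  nlinarith

/-- If the expected quasi-likelihood at `θ` is finite and not larger than its value at the true
parameter, the filter at `θ` recovers the volatility. -/
theorem ContinuouslyInvertible.link_eq_of_integral_le
    (hinv : M.ContinuouslyInvertible Θ K P X g)
    (hS : M.IsSolution θ₀ P Z S) (hZ : IsInnovation P Z) (hX : ∀ t ω, X t ω = √(S t ω) * Z t ω)
    (hLB : M.LB K) (hu : u ∈ contSpace Θ K) (hlog : Integrable (fun ω => Real.log (S 0 ω)) P)
    {θ : E} (hθ : θ ∈ Θ)
    (hint : Integrable
      (fun ω => X 0 ω ^ 2 / M.link (g 0 θ ω) + Real.log (M.link (g 0 θ ω))) P)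
    (hle : ∫ ω, (X 0 ω ^ 2 / M.link (g 0 θ ω) + Real.log (M.link (g 0 θ ω))) ∂P ≤
      1 + ∫ ω, Real.log (S 0 ω) ∂P) :
    ∀ᵐ ω ∂P, M.link (g 0 θ ω) = S 0 ω := by
  obtain ⟨-, -, m, hm, hmK⟩ := hLB
  have hXm := hS.measurable_obs hZ hX
  have hgm := hinv.isStationaryFilter.measurable 0 θ hθ
  have hgK : ∀ᵐ ω ∂P, m ≤ M.link (g 0 θ ω) := by
    filter_upwards [hinv.isStationaryFilter.mem 0 θ hθ] with ω hω using hmK _ hω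
  have hlinkm : Measurable fun ω => M.link (g 0 θ ω) := M.measurable_link.comp hgm
  obtain ⟨G, hG, hgG⟩ := hinv.exists_eq_pastPath hXm hu hθ
  -- The logarithm is bounded below by `log m` and above by the whole contribution, since the
  -- quotient is nonnegative.
  have hb : Integrable (fun ω => Real.log (M.link (g 0 θ ω))) P := by
    refine (hint.abs.add (integrable_const |Real.log m|)).mono'
      (Real.measurable_log.comp hlinkm).aestronglyMeasurable ?_
    filter_upwards [hgK] with ω hω
    have h1 : Real.log m ≤ Real.log (M.link (g 0 θ ω)) := Real.log_le_log hm hω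
    have h2 : 0 ≤ X 0 ω ^ 2 / M.link (g 0 θ ω) := div_nonneg (sq_nonneg _) (hm.le.trans hω)
    rw [Real.norm_eq_abs, Pi.add_apply, abs_le]
    constructor
    · linarith [neg_abs_le (Real.log m), abs_nonneg (X 0 ω ^ 2 / M.link (g 0 θ ω) +
        Real.log (M.link (g 0 θ ω)))]
    · linarith [le_abs_self (X 0 ω ^ 2 / M.link (g 0 θ ω) + Real.log (M.link (g 0 θ ω))),
        abs_nonneg (Real.log m)]
  set r : Ω → ℝ := fun ω => S 0 ω / M.link (g 0 θ ω) with hr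
  have hrm : Measurable r := (hS.measurable 0).div hlinkm
  have hA : (fun ω => X 0 ω ^ 2 / M.link (g 0 θ ω)) =ᵐ[P] fun ω => Z 0 ω ^ 2 * r ω := by
    filter_upwards [hS.ae_pos 0] with ω hω
    rw [hX, mul_pow, Real.sq_sqrt hω.le, hr]; ring
  have hindep : IndepFun (fun ω => Z 0 ω ^ 2) r P := by
    have h1 := (hS.indepFun_past_future hZ 0).comp
      (φ := fun p => p.1 / M.link (G fun n => √(p.2 n).1 * (p.2 n).2))
      (ψ := fun z : ℕ → ℝ => z 0 ^ 2)
      (measurable_fst.div (M.measurable_link.comp (hG.comp (by fun_prop)))) (by fun_prop)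
    refine h1.symm.congr (ae_of_all _ fun ω => ?_) ?_
    · simp [futurePath]
    · filter_upwards [hgG 0] with ω hω
      simp only [Function.comp, hr, hω]
      congr 3
      funext n
      simp [pastPath, pairPath, hX]
  have hAint : Integrable (fun ω => Z 0 ω ^ 2 * r ω) P := by
    refine Integrable.congr ?_ hA
    refine (hint.sub hb).congr (ae_of_all _ fun ω => ?_)
    simp
  have hZ0 : ¬ (fun ω => Z 0 ω ^ 2) =ᵐ[P] 0 := fun h => by
    have := integral_congr_ae h
    rw [hZ.variance] at this
    simp at this
  -- Integrability of a product of independent factors passes to one factor when the other is not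
  -- almost surely zero; `Z_0²` has mean `1`.
  have hrint : Integrable r P :=
    hindep.integrable_right_of_integrable_op (· * ·) 1 one_ne_zero (by simp [enorm_mul]) hAint
      hZ.integrable_sq.aestronglyMeasurable hrm.aestronglyMeasurable hZ0
  have hAr : ∫ ω, X 0 ω ^ 2 / M.link (g 0 θ ω) ∂P = ∫ ω, r ω ∂P := by
    rw [integral_congr_ae hA]
    have := hindep.integral_mul_eq_mul_integral hZ.integrable_sq.aestronglyMeasurable
      hrm.aestronglyMeasurable
    rw [hZ.variance, one_mul] at this
    exact this
  have hnonneg : ∀ᵐ ω ∂P, 0 ≤ r ω - 1 - (Real.log (S 0 ω) - Real.log (M.link (g 0 θ ω))) := by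
    filter_upwards [hS.ae_pos 0, hgK] with ω h1 h2
    have h3 := hm.trans_le h2
    rw [← Real.log_div h1.ne' h3.ne']
    linarith [Real.log_le_sub_one_of_pos (div_pos h1 h3)]
  have hi1 : Integrable (fun ω => r ω - 1) P := hrint.sub (integrable_const 1)
  have hi2 : Integrable (fun ω => Real.log (S 0 ω) - Real.log (M.link (g 0 θ ω))) P :=
    hlog.sub hb
  have hX2 : Integrable (fun ω => X 0 ω ^ 2 / M.link (g 0 θ ω)) P := hAint.congr hA.symm
  have hzero : ∫ ω, (r ω - 1 - (Real.log (S 0 ω) - Real.log (M.link (g 0 θ ω)))) ∂P = 0 := by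
    refine le_antisymm ?_ (integral_nonneg_of_ae hnonneg)
    rw [integral_add hX2 hb, hAr] at hle
    rw [integral_sub hi1 hi2, integral_sub hlog hb, integral_sub hrint (integrable_const 1)]
    simp only [integral_const, probReal_univ, smul_eq_mul, mul_one]
    linarith
  filter_upwards [(integral_eq_zero_iff_of_nonneg_ae hnonneg (hi1.sub hi2)).1 hzero,
    hS.ae_pos 0, hgK] with ω h1 h2 h3
  have h4 := hm.trans_le h3
  simp only [Pi.zero_apply] at h1
  rw [← Real.log_div h2.ne' h4.ne'] at h1
  by_contra hne
  have h5 := Real.log_lt_sub_one_of_pos (div_pos h2 h4) 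
    fun h => hne ((div_eq_one_iff_eq h4.ne').1 h).symm
  simp only [hr] at h1
  linarith

end VolatilityModel

/-! ### Truncated contributions and local oscillation. -/

namespace VolatilityModel

variable {E : Type*}

/-- The quasi-likelihood contribution of an observation with square `ξ` at the state `x`, with `ξ`
and the contribution both truncated at the level `N`. -/
noncomputable def truncLik (M : VolatilityModel E) (N ξ x : ℝ) : ℝ :=
  min N (min ξ N * (1 / M.link x) + Real.log (M.link x))

lemma measurable_truncLik (M : VolatilityModel E) (N : ℝ) :
    Measurable (fun p : ℝ × ℝ => M.truncLik N p.1 p.2) := by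
  have := M.measurable_link
  unfold truncLik
  fun_prop

lemma tendsto_truncLik (M : VolatilityModel E) (ξ x : ℝ) :
    Tendsto (fun N : ℕ => M.truncLik N ξ x) atTop
      (𝓝 (ξ / M.link x + Real.log (M.link x))) := by
  refine tendsto_const_nhds.congr' ?_
  filter_upwards [tendsto_natCast_atTop_atTop.eventually_ge_atTop ξ,
    tendsto_natCast_atTop_atTop.eventually_ge_atTop (ξ / M.link x + Real.log (M.link x))]
    with N h1 h2
  rw [truncLik, min_eq_left h1, ← div_eq_mul_one_div, min_eq_right h2]

lemma log_le_truncLik {M : VolatilityModel E} {m N ξ x : ℝ} (hm : 0 < m) (hN : 0 ≤ N)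
    (hmN : Real.log m ≤ N) (hξ : 0 ≤ ξ) (hx : m ≤ M.link x) : Real.log m ≤ M.truncLik N ξ x := by
  have h1 : 0 ≤ min ξ N * (1 / M.link x) :=
    mul_nonneg (le_min hξ hN) (one_div_nonneg.2 (hm.le.trans hx))
  exact le_min hmN (by linarith [Real.log_le_log hm hx])

/-- Under (LB) the truncated contribution at `y`, up to a multiple of `min 1 |x - y|`, is a lower
bound for the contribution at `x`. -/
lemma LB.exists_truncLik_sub_le {M : VolatilityModel E} {K : Set ℝ} (hLB : M.LB K) {N : ℝ}
    (hN : 0 ≤ N) :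
    ∃ D : ℝ, 0 ≤ D ∧ ∀ x ∈ K, ∀ y ∈ K, ∀ ξ, 0 ≤ ξ →
      M.truncLik N ξ y - D * min 1 |x - y| ≤ ξ / M.link x + Real.log (M.link x) := by
  obtain ⟨⟨C₁, hC₁⟩, ⟨C₂, hC₂⟩, m, hm, hmK⟩ := hLB
  -- The first constant is the Lipschitz bound after truncation, for states within distance `1`. The
  -- second covers distant states, where the upper bound `N` is compared with the lower bound `log
  -- m`.
  refine ⟨max (N * C₁ + C₂) (N - Real.log m), le_max_of_le_left (by positivity), ?_⟩
  intro x hx y hy ξ hξ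
  have hlx := hm.trans_le (hmK x hx)
  have h0 : 0 ≤ min ξ N := le_min hξ hN
  have hinv : 0 ≤ 1 / M.link x := one_div_nonneg.2 hlx.le
  have htr : min ξ N * (1 / M.link x) ≤ ξ / M.link x := by
    rw [div_eq_mul_one_div ξ]
    exact mul_le_mul_of_nonneg_right (min_le_left _ _) hinv
  rcases le_total |x - y| 1 with h | h
  · rw [min_eq_right h]
    have h1 := hC₁.dist_le_mul x hx y hy
    have h2 := hC₂.dist_le_mul x hx y hy
    rw [Real.dist_eq, Real.dist_eq, abs_le] at h1 h2
    have h3 : M.truncLik N ξ y ≤ min ξ N * (1 / M.link y) + Real.log (M.link y) := min_le_right _ _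
    have h4 : min ξ N * (1 / M.link y - 1 / M.link x) ≤ N * (C₁ * |x - y|) :=
      (mul_le_mul_of_nonneg_left (by linarith [h1.1]) h0).trans
        (mul_le_mul_of_nonneg_right (min_le_right _ _) (by positivity))
    have h5 := mul_le_mul_of_nonneg_right (le_max_left (N * (C₁ : ℝ) + C₂) (N - Real.log m))
      (abs_nonneg (x - y))
    linarith [h2.1]
  · rw [min_eq_left h]
    have h1 : M.truncLik N ξ y ≤ N := min_le_left _ _
    have h2 := le_max_right (N * (C₁ : ℝ) + C₂) (N - Real.log m)
    have h3 := Real.log_le_log hm (hmK x hx)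
    have h4 := mul_nonneg h0 hinv
    linarith

lemma min_one_abs_le_toReal {Θ : Set E} {θ : E} (hθ : θ ∈ Θ) (f : E → ℝ) :
    min 1 |f θ| ≤ (min 1 (supNorm Θ f)).toReal := by
  have h1 := ENNReal.toReal_mono (ne_top_of_le_ne_top ENNReal.one_ne_top (min_le_left _ _))
    (min_le_min_left 1 (enorm_le_supNorm hθ f))
  rwa [ENNReal.toReal_min ENNReal.one_ne_top enorm_ne_top, ENNReal.toReal_one, toReal_enorm,
    Real.norm_eq_abs] at h1

lemma min_one_abs_sub_le (a b c : ℝ) : min 1 |a - c| ≤ min 1 |a - b| + min 1 |b - c| := by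
  have h := abs_sub_le a b c
  rcases le_total 1 |a - b| with h1 | h1 <;> rcases le_total 1 |b - c| with h2 | h2 <;>
    simp only [h1, h2, min_eq_left, min_eq_right] <;>
    linarith [min_le_left 1 |a - c|, min_le_right 1 |a - c|, abs_nonneg (a - b), abs_nonneg (b - c)]

/-- The oscillation, truncated at one, of the values `v i` attached to the points `q i` around the
value `v₀` attached to `θ`, over the points within `1 / (k + 1)` of `θ`. -/
noncomputable def truncOsc [MetricSpace E] (q : ℕ → E) (θ : E) (k : ℕ) (v : ℕ → ℝ) (v₀ : ℝ) : ℝ :=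
  ⨆ i, if dist (q i) θ < 1 / ((k : ℝ) + 1) then min 1 |v i - v₀| else 0

section Osc

variable [MetricSpace E] (q : ℕ → E) (θ : E) (k : ℕ) (v : ℕ → ℝ) (v₀ : ℝ)

lemma truncOsc_term_mem (i : ℕ) :
    (if dist (q i) θ < 1 / ((k : ℝ) + 1) then min 1 |v i - v₀| else 0) ∈ Set.Icc (0 : ℝ) 1 := by
  split_ifs
  · exact ⟨le_min zero_le_one (abs_nonneg _), min_le_left _ _⟩
  · exact ⟨le_rfl, zero_le_one⟩

lemma bddAbove_truncOsc : BddAbove (Set.range fun i =>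
    if dist (q i) θ < 1 / ((k : ℝ) + 1) then min 1 |v i - v₀| else 0) :=
  ⟨1, by rintro _ ⟨i, rfl⟩; exact (truncOsc_term_mem q θ k v v₀ i).2⟩

lemma truncOsc_nonneg : 0 ≤ truncOsc q θ k v v₀ :=
  Real.iSup_nonneg fun i => (truncOsc_term_mem q θ k v v₀ i).1

lemma truncOsc_le_one : truncOsc q θ k v v₀ ≤ 1 :=
  ciSup_le fun i => (truncOsc_term_mem q θ k v v₀ i).2

lemma antitone_truncOsc : Antitone fun k => truncOsc q θ k v v₀ := by
  intro k k' hk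
  refine ciSup_mono (bddAbove_truncOsc q θ k v v₀) fun i => ?_
  have h1 : 1 / ((k' : ℝ) + 1) ≤ 1 / ((k : ℝ) + 1) := Nat.one_div_le_one_div hk
  split_ifs with h2 h3 h3
  · exact le_rfl
  · exact absurd (h2.trans_le h1) h3
  · exact le_min zero_le_one (abs_nonneg _)
  · exact le_rfl

variable {q θ k v v₀}

lemma le_truncOsc {i : ℕ} (hi : dist (q i) θ < 1 / ((k : ℝ) + 1)) :
    min 1 |v i - v₀| ≤ truncOsc q θ k v v₀ := by
  refine le_ciSup_of_le (bddAbove_truncOsc q θ k v v₀) i ?_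
  rw [if_pos hi]

/-- Comparison of a function continuous on `Θ` with an arbitrary function, through the oscillation
of the latter along a dense sequence and the uniform distance of the two. -/
lemma min_one_abs_sub_le_truncOsc {Θ : Set E} {f v : E → ℝ} (hf : ContinuousOn f Θ)
    (hqΘ : ∀ i, q i ∈ Θ) (hq : Θ ⊆ closure (Set.range q)) {θ' : E} (hθ' : θ' ∈ Θ)
    (hd : dist θ' θ < 1 / ((k : ℝ) + 1)) :
    min 1 |f θ' - v θ| ≤ (min 1 (supNorm Θ fun θ => f θ - v θ)).toReal +
      truncOsc q θ k (fun i => v (q i)) (v θ) := by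
  refine le_of_forall_pos_le_add fun η hη => ?_
  obtain ⟨δ, hδ, hcont⟩ := Metric.continuousOn_iff.1 hf θ' hθ' η hη
  -- The point of the sequence is close enough to `θ'` for continuity of `f`, and also stays inside
  -- the ball around `θ`.
  obtain ⟨_, ⟨i, rfl⟩, hi⟩ := Metric.mem_closure_iff.1 (hq hθ')
    (min δ (1 / ((k : ℝ) + 1) - dist θ' θ)) (lt_min hδ (sub_pos.2 hd))
  rw [dist_comm] at hi
  have h1 : |f (q i) - f θ'| < η := by
    rw [← Real.dist_eq]; exact hcont _ (hqΘ i) (hi.trans_le (min_le_left _ _))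
  have h2 : dist (q i) θ < 1 / ((k : ℝ) + 1) := by
    have := hi.trans_le (min_le_right _ _)
    linarith [dist_triangle (q i) θ' θ]
  have h3 := min_one_abs_le_toReal (hqΘ i) (fun θ => f θ - v θ)
  have h4 := le_truncOsc (v := fun i => v (q i)) (v₀ := v θ) h2
  have h5 := min_one_abs_sub_le (f θ') (f (q i)) (v θ)
  have h6 := min_one_abs_sub_le (f (q i)) (v (q i)) (v θ)
  have h7 := min_le_right 1 |f θ' - f (q i)|
  rw [abs_sub_comm (f θ')] at h7
  rw [abs_sub_comm (f θ') (f (q i))] at h5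
  linarith

/-- The oscillation of a function at a point is at most twice its uniform distance to a function
which is continuous on `Θ`. -/
lemma iInf_truncOsc_le {Θ : Set E} {f v : E → ℝ} (hf : ContinuousOn f Θ) (hqΘ : ∀ i, q i ∈ Θ)
    (hθ : θ ∈ Θ) :
    ⨅ k, truncOsc q θ k (fun i => v (q i)) (v θ) ≤
      2 * (min 1 (supNorm Θ fun θ => f θ - v θ)).toReal := by
  set e := (min 1 (supNorm Θ fun θ => f θ - v θ)).toReal with he
  refine le_of_forall_pos_le_add fun η hη => ?_
  obtain ⟨δ, hδ, hcont⟩ := Metric.continuousOn_iff.1 hf θ hθ η hη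
  obtain ⟨k, hk⟩ := exists_nat_one_div_lt hδ
  refine ciInf_le_of_le ⟨0, by rintro _ ⟨k, rfl⟩; exact truncOsc_nonneg _ _ _ _ _⟩ k ?_
  refine ciSup_le fun i => ?_
  have he0 : 0 ≤ e := ENNReal.toReal_nonneg
  split_ifs with h
  · have h1 : |f (q i) - f θ| < η := by
      rw [← Real.dist_eq]; exact hcont _ (hqΘ i) (h.trans hk)
    have h2 := min_one_abs_le_toReal (hqΘ i) (fun θ => f θ - v θ)
    have h3 := min_one_abs_le_toReal hθ (fun θ => f θ - v θ)
    have h4 := min_one_abs_sub_le (v (q i)) (f (q i)) (v θ)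
    have h5 := min_one_abs_sub_le (f (q i)) (f θ) (v θ)
    have h6 := min_le_right 1 |f (q i) - f θ|
    rw [abs_sub_comm (v (q i)) (f (q i))] at h4
    have h7 : min 1 |v (q i) - v θ| ≤ 2 * e + η := by linarith
    exact h7
  · linarith

end Osc

end VolatilityModel

/-! ### Separation of the true parameter. -/

namespace VolatilityModel

section Contrast

variable {E : Type*} [TopologicalSpace E] {Ω : Type*} [MeasurableSpace Ω] {P : Measure Ω}
  [IsProbabilityMeasure P] {M : VolatilityModel E} {θ₀ : E} {Θ : Set E} {K : Set ℝ}
  {Z S X : ℤ → Ω → ℝ} {g : ℤ → E → Ω → ℝ} {u : E → ℝ}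

/-- The truncated contribution is bounded, above by `N` and below by `min N (log m)`, so no moment
of `X_0` is involved. -/
lemma ContinuouslyInvertible.integrable_truncLik (hinv : M.ContinuouslyInvertible Θ K P X g)
    (hXm : Measurable (X 0)) (hLB : M.LB K) {θ : E} (hθ : θ ∈ Θ) {N : ℝ} (hN : 0 ≤ N) :
    Integrable (fun ω => M.truncLik N (X 0 ω ^ 2) (g 0 θ ω)) P := by
  obtain ⟨-, -, m, hm, hmK⟩ := hLB
  have hgm := hinv.isStationaryFilter.measurable 0 θ hθ
  refine (integrable_const (max N |Real.log m|)).mono' ((M.measurable_truncLik N).comp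
    ((hXm.pow_const 2).prodMk hgm)).aestronglyMeasurable ?_
  filter_upwards [hinv.isStationaryFilter.mem 0 θ hθ] with ω hω
  have h1 : M.truncLik N (X 0 ω ^ 2) (g 0 θ ω) ≤ N := min_le_left _ _
  have h2 : min N (Real.log m) ≤ M.truncLik N (X 0 ω ^ 2) (g 0 θ ω) := by
    have h3 : 0 ≤ min (X 0 ω ^ 2) N * (1 / M.link (g 0 θ ω)) :=
      mul_nonneg (le_min (sq_nonneg _) hN) (one_div_nonneg.2 (hm.le.trans (hmK _ hω)))
    exact min_le_min_left _ (by linarith [Real.log_le_log hm (hmK _ hω)])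
  have h3 : -max N |Real.log m| ≤ min N (Real.log m) :=
    le_min (by linarith [le_max_left N |Real.log m|])
      (by linarith [le_max_right N |Real.log m|, neg_abs_le (Real.log m)])
  rw [Real.norm_eq_abs, abs_le]
  exact ⟨h3.trans h2, h1.trans (le_max_left _ _)⟩

/-- Away from the true parameter the truncated expected quasi-likelihood exceeds, at a high enough
truncation level, the expected quasi-likelihood at the true parameter. -/
theorem ContinuouslyInvertible.exists_lt_integral_truncLik
    (hinv : M.ContinuouslyInvertible Θ K P X g) (hS : M.IsSolution θ₀ P Z S)
    (hZ : IsInnovation P Z) (hX : ∀ t ω, X t ω = √(S t ω) * Z t ω) (hLB : M.LB K)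
    (hu : u ∈ contSpace Θ K) (hlog : Integrable (fun ω => Real.log (S 0 ω)) P)
    {θ : E} (hθ : θ ∈ Θ) (hne : ¬ ∀ᵐ ω ∂P, M.link (g 0 θ ω) = S 0 ω) :
    ∃ N : ℕ, 1 + ∫ ω, Real.log (S 0 ω) ∂P <
      ∫ ω, M.truncLik N (X 0 ω ^ 2) (g 0 θ ω) ∂P := by
  by_contra! hcon
  refine hne ?_
  have hXm := hS.measurable_obs hZ hX 0
  have hgm := hinv.isStationaryFilter.measurable 0 θ hθ
  have hint := fun N : ℕ => hinv.integrable_truncLik hXm hLB hθ (Nat.cast_nonneg N)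
  have hLB' := hLB
  obtain ⟨-, -, m, hm, hmK⟩ := hLB'
  set L := 1 + ∫ ω, Real.log (S 0 ω) ∂P with hL
  set a := Real.log m with ha
  set l : Ω → ℝ := fun ω => X 0 ω ^ 2 / M.link (g 0 θ ω) + Real.log (M.link (g 0 θ ω)) with hl
  have hlm : Measurable l := ((hXm.pow_const 2).div (M.measurable_link.comp hgm)).add
    (Real.measurable_log.comp (M.measurable_link.comp hgm))
  have hgK : ∀ᵐ ω ∂P, m ≤ M.link (g 0 θ ω) := by
    filter_upwards [hinv.isStationaryFilter.mem 0 θ hθ] with ω hω using hmK _ hω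
  obtain ⟨N₀, hN₀⟩ := exists_nat_ge a
  have hnn : ∀ N : ℕ, N₀ ≤ N →
      0 ≤ᵐ[P] fun ω => M.truncLik N (X 0 ω ^ 2) (g 0 θ ω) - a := fun N hN => by
    filter_upwards [hgK] with ω hω
    exact sub_nonneg.2 (log_le_truncLik hm (Nat.cast_nonneg N)
      (hN₀.trans (Nat.cast_le.2 hN)) (sq_nonneg _) hω)
  have hsub : ∀ N : ℕ, ∫ ω, (M.truncLik N (X 0 ω ^ 2) (g 0 θ ω) - a) ∂P ≤ L - a := fun N => by
    rw [integral_sub (hint N) (integrable_const a)]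
    simpa using hcon N
  have hLa : 0 ≤ L - a := (integral_nonneg_of_ae (hnn N₀ le_rfl)).trans (hsub N₀)
  have hlnn : 0 ≤ᵐ[P] fun ω => l ω - a := by
    filter_upwards [hgK] with ω hω
    have h1 : 0 ≤ X 0 ω ^ 2 / M.link (g 0 θ ω) := div_nonneg (sq_nonneg _) (hm.le.trans hω)
    have h2 := Real.log_le_log hm hω
    simp only [Pi.zero_apply, hl, ha]
    linarith
  -- If no truncation level sufficed, Fatou's lemma, after subtracting the lower bound `a = log m`,
  -- would make the untruncated contribution integrable with mean at most `L`, and the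
  -- identification inequality would apply.
  have hfatou : ∫⁻ ω, ENNReal.ofReal (l ω - a) ∂P ≤ ENNReal.ofReal (L - a) := by
    have hlim : ∀ ω, liminf (fun N : ℕ =>
        ENNReal.ofReal (M.truncLik N (X 0 ω ^ 2) (g 0 θ ω) - a)) atTop =
        ENNReal.ofReal (l ω - a) := fun ω =>
      (ENNReal.tendsto_ofReal ((M.tendsto_truncLik _ _).sub_const a)).liminf_eq
    calc ∫⁻ ω, ENNReal.ofReal (l ω - a) ∂P
        = ∫⁻ ω, liminf (fun N : ℕ =>
            ENNReal.ofReal (M.truncLik N (X 0 ω ^ 2) (g 0 θ ω) - a)) atTop ∂P := by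
          simp only [hlim]
      _ ≤ liminf (fun N : ℕ =>
            ∫⁻ ω, ENNReal.ofReal (M.truncLik N (X 0 ω ^ 2) (g 0 θ ω) - a) ∂P) atTop :=
          lintegral_liminf_le fun N => (((M.measurable_truncLik N).comp
            ((hXm.pow_const 2).prodMk hgm)).sub_const a).ennreal_ofReal
      _ ≤ ENNReal.ofReal (L - a) := by
          refine liminf_le_of_frequently_le' (Eventually.frequently ?_)
          filter_upwards [eventually_ge_atTop N₀] with N hN
          have hi : Integrable (fun ω => M.truncLik N (X 0 ω ^ 2) (g 0 θ ω) - a) P :=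
            (hint N).sub (integrable_const a)
          rw [← ofReal_integral_eq_lintegral_ofReal hi (hnn N hN)]
          exact ENNReal.ofReal_le_ofReal (hsub N)
  have hli : Integrable (fun ω => l ω - a) P :=
    (lintegral_ofReal_ne_top_iff_integrable (hlm.sub_const a).aestronglyMeasurable hlnn).1
      (ne_top_of_le_ne_top ENNReal.ofReal_ne_top hfatou)
  have hli' : Integrable l P :=
    (hli.add (integrable_const a)).congr (ae_of_all _ fun ω => by simp)
  refine hinv.link_eq_of_integral_le hS hZ hX hLB hu hlog hθ hli' ?_
  have h1 : ∫ ω, (l ω - a) ∂P ≤ L - a := by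
    rw [← ofReal_integral_eq_lintegral_ofReal hli hlnn] at hfatou
    exact (ENNReal.ofReal_le_ofReal_iff hLa).1 hfatou
  rw [integral_sub hli' (integrable_const a)] at h1
  simpa using h1

end Contrast

section Consistency

variable {E : Type*} [MetricSpace E] {Ω : Type*} [MeasurableSpace Ω] {P : Measure Ω}
  [IsProbabilityMeasure P] {M : VolatilityModel E} {θ₀ : E} {Θ : Set E} {K : Set ℝ}
  {Z S X : ℤ → Ω → ℝ} {g : ℤ → E → Ω → ℝ} {u : E → ℝ}

/-- Oscillations along a sequence are countable suprema, hence measurable. The sequence must lie in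
`Θ`, where the filter is controlled. -/
lemma _root_.IsCompact.exists_seq_dense {Θ : Set E} (hΘ : IsCompact Θ) (hne : Θ.Nonempty) :
    ∃ q : ℕ → E, (∀ i, q i ∈ Θ) ∧ Θ ⊆ closure (Set.range q) := by
  obtain ⟨T, hT, hTc, hΘT⟩ := hΘ.isSeparable.exists_countable_dense_subset
  have hTne : T.Nonempty := closure_nonempty_iff.1 (hne.mono hΘT)
  obtain ⟨q, rfl⟩ := hTc.exists_eq_range hTne
  exact ⟨q, fun i => hT ⟨i, rfl⟩, hΘT⟩

lemma tendsto_toReal_min_one {s : ℕ → ℝ≥0∞} (hs : Tendsto s atTop (𝓝 0)) :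
    Tendsto (fun t => (min 1 (s t)).toReal) atTop (𝓝 0) := by
  have h1 : Tendsto (fun t => min 1 (s t)) atTop (𝓝 0) :=
    tendsto_of_tendsto_of_tendsto_of_le_of_le tendsto_const_nhds hs (fun _ => zero_le)
      fun t => min_le_right _ _
  exact (ENNReal.tendsto_toReal ENNReal.zero_ne_top).comp h1

/-- Every parameter other than the true one has a neighbourhood in `Θ` on which the quasi-likelihood
eventually exceeds its value at the true parameter. -/
theorem ContinuouslyInvertible.exists_ball_quasiLik_lt
    (hinv : M.ContinuouslyInvertible Θ K P X g) (hcont : M.PreservesContSpace Θ K P X)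
    (hST : M.ST θ₀ P Z S) (hZ : IsInnovation P Z) (hX : ∀ t ω, X t ω = √(S t ω) * Z t ω)
    (hΘ : IsCompact Θ) (hLB : M.LB K) (hID : M.ID θ₀ Θ P (g 0) (S 0)) (hu : u ∈ contSpace Θ K)
    (hθ₀ : θ₀ ∈ Θ) {θ : E} (hθ : θ ∈ Θ) (hne : θ ≠ θ₀) :
    ∃ δ > 0, ∀ᵐ ω ∂P, ∀ᶠ n in atTop, ∀ θ' ∈ Θ, dist θ' θ < δ →
      M.quasiLik (fun s => X s ω) u n θ₀ < M.quasiLik (fun s => X s ω) u n θ' := by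
  have hS := hST.isSolution
  have h0 := (hID θ₀ hθ₀).2 rfl
  have hlog := hS.integrable_log hinv hLB hθ₀ h0
  have hXm := hS.measurable_obs hZ hX
  have hY := hS.measurable_pairPath hZ
  obtain ⟨N, hN⟩ := hinv.exists_lt_integral_truncLik hS hZ hX hLB hu hlog hθ
    fun h => hne ((hID θ hθ).1 h)
  set L := 1 + ∫ ω, Real.log (S 0 ω) ∂P with hL
  set V := ∫ ω, M.truncLik N (X 0 ω ^ 2) (g 0 θ ω) ∂P with hV
  obtain ⟨D, hD0, hD⟩ := hLB.exists_truncLik_sub_le (Nat.cast_nonneg N)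
  obtain ⟨q, hqΘ, hq⟩ := hΘ.exists_seq_dense ⟨θ₀, hθ₀⟩
  -- Writing the filter at `θ` and along the sequence as fixed functionals of the past turns its
  -- oscillation into a functional of the shifted path, to which the ergodic theorem applies.
  choose G hGm hG using fun i => hinv.exists_eq_pastPath hXm hu (hqΘ i)
  obtain ⟨Gθ, hGθm, hGθ⟩ := hinv.exists_eq_pastPath hXm hu hθ
  let past : (ℤ → ℝ × ℝ) → ℕ → ℝ := fun y => pastPath 0 (obsPath y)
  have hpastm : Measurable past := (measurable_pastPath 0).comp measurable_obsPath
  have hpast : ∀ (t : ℤ) ω, past (pathShift t (pairPath S Z ω)) = pastPath t (fun s => X s ω) :=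
    fun t ω => by
      simp only [past, obsPath_pathShift, pastPath_pathShift, zero_add, obsPath_pairPath hX]
  have hpast0 : ∀ ω, past (pairPath S Z ω) = pastPath 0 (fun s => X s ω) := fun ω => by
    simp only [past, obsPath_pairPath hX]
  let d : ℕ → (ℤ → ℝ × ℝ) → ℝ := fun k y => truncOsc q θ k (fun i => G i (past y)) (Gθ (past y))
  have hdm : ∀ k, Measurable (d k) := fun k => by
    refine Measurable.iSup fun i => ?_
    have h1 := (hGm i).comp hpastm
    have h2 := hGθm.comp hpastm
    split_ifs
    · exact measurable_const.min (h1.sub h2).abs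
    · exact measurable_const
  have hgood : ∀ᵐ ω ∂P, ∀ t : ℤ, g t θ ω = Gθ (pastPath t (fun s => X s ω)) ∧
      ∀ i, g t (q i) ω = G i (pastPath t (fun s => X s ω)) := by
    filter_upwards [ae_all_iff.2 hGθ, ae_all_iff.2 fun i => ae_all_iff.2 (hG i)] with ω h1 h2 t
    exact ⟨h1 t, fun i => h2 i t⟩
  have hdg : ∀ᵐ ω ∂P, ∀ (t : ℤ) k, d k (pathShift t (pairPath S Z ω)) =
      truncOsc q θ k (fun i => g t (q i) ω) (g t θ ω) := by
    filter_upwards [hgood] with ω hω t k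
    simp only [d, hpast, (hω t).1, (hω t).2]
  have hdlim : Tendsto (fun k => ∫ ω, d k (pairPath S Z ω) ∂P) atTop (𝓝 0) := by
    refine hS.tendsto_integral_zero hZ hdm (fun k y => truncOsc_nonneg _ _ _ _ _)
      (fun k y => truncOsc_le_one _ _ _ _ _) (fun y => antitone_truncOsc _ _ _ _) ?_
    filter_upwards [hdg, hinv.tendsto u hu, hcont.ae_gHat_mem hu] with ω h1 h2 h3
    simp only [h1]
    refine tendsto_of_tendsto_of_tendsto_of_le_of_le tendsto_const_nhds
      (by simpa using (tendsto_toReal_min_one h2).const_mul 2)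
      (fun t => le_ciInf fun k => truncOsc_nonneg _ _ _ _ _)
      fun t => iInf_truncOsc_le (v := fun θ => g t θ ω) (h3 t).1 hqΘ hθ
  -- The oscillation may cost less than half of the gap `V - L`, so the midpoint `(V + L) / 2`
  -- separates the two limits.
  obtain ⟨k, hk⟩ := ((hdlim.const_mul D).eventually
    (gt_mem_nhds (show D * 0 < (V - L) / 2 by linarith))).exists
  refine ⟨1 / ((k : ℝ) + 1), Nat.one_div_pos_of_nat, ?_⟩
  let v : (ℤ → ℝ × ℝ) → ℝ := fun y => M.truncLik N (obsPath y 0 ^ 2) (Gθ (past y))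
  have hvm : Measurable v := (M.measurable_truncLik N).comp
    ((((measurable_pi_apply 0).comp measurable_obsPath).pow_const 2).prodMk (hGθm.comp hpastm))
  have hv0 : (fun ω => M.truncLik N (X 0 ω ^ 2) (g 0 θ ω)) =ᵐ[P] fun ω => v (pairPath S Z ω) := by
    filter_upwards [hgood] with ω hω
    simp only [v, hpast0, obsPath_pairPath hX, (hω 0).1]
  have hvi : Integrable (fun ω => v (pairPath S Z ω)) P :=
    (hinv.integrable_truncLik (hXm 0) hLB hθ (Nat.cast_nonneg N)).congr hv0
  have hav1 := hST.ae_tendsto_average hZ hvm hvi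
  rw [← integral_congr_ae hv0, ← hV] at hav1
  have hdi : Integrable (fun ω => d k (pairPath S Z ω)) P :=
    (integrable_const (1 : ℝ)).mono' ((hdm k).comp hY).aestronglyMeasurable
      (ae_of_all _ fun ω => by
        rw [Real.norm_eq_abs, abs_of_nonneg (truncOsc_nonneg _ _ _ _ _)]
        exact truncOsc_le_one _ _ _ _ _)
  have hav2 := hST.ae_tendsto_average hZ (hdm k) hdi
  have hup := hinv.eventually_quasiLik_lt hcont hST hZ hX hLB hu hθ₀ h0
    (c := (V + L) / 2) (by linarith)
  filter_upwards [hav1, hav2, hup, hinv.tendsto u hu, hcont.ae_gHat_mem hu, hgood, hdg,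
    ae_all_iff.2 fun t => hinv.isStationaryFilter.mem t θ hθ] with ω h1 h2 h3 h4 h5 h6 h7 h8
  have he := tendsto_average_zero (tendsto_toReal_min_one h4)
  have hlim := h1.sub ((he.add h2).const_mul D)
  rw [zero_add] at hlim
  filter_upwards [h3, hlim.eventually
    (lt_mem_nhds (show (V + L) / 2 < V - D * ∫ ω, d k (pairPath S Z ω) ∂P by linarith))]
    with n hn1 hn2 θ' hθ' hdist
  have hn3 : (V + L) / 2 < 2 * M.quasiLik (fun s => X s ω) u n θ' := by
    refine hn2.trans_le ?_
    rw [two_mul_quasiLik, ← add_div, ← mul_div_assoc, ← sub_div, ← Finset.sum_add_distrib,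
      Finset.mul_sum, ← Finset.sum_sub_distrib]
    refine div_le_div_of_nonneg_right (Finset.sum_le_sum fun t _ => ?_) (Nat.cast_nonneg n)
    have hmem := (h5 t).2 hθ'
    have h9 := hD _ hmem _ (h8 t) _ (sq_nonneg (X t ω))
    have h10 := min_one_abs_sub_le_truncOsc (v := fun θ => g t θ ω) (h5 t).1 hqΘ hq hθ' hdist
    have h11 : v (pathShift t (pairPath S Z ω)) = M.truncLik N (X t ω ^ 2) (g t θ ω) := by
      simp only [v, hpast, (h6 t).1, obsPath_pathShift, obsPath_pairPath hX, pathShift, zero_add]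
    rw [h11, h7 t k]
    linarith [mul_le_mul_of_nonneg_left h10 hD0]
  linarith

end Consistency

end VolatilityModel

/-! ### Strong consistency by compactness. -/

theorem theorem3p1 {E : Type*} [MetricSpace E] {Ω : Type*} [MeasurableSpace Ω]
    (P : Measure Ω) [IsProbabilityMeasure P]
    (M : VolatilityModel E) (θ₀ : E) (Θ : Set E) (K : Set ℝ)
    (Z S X : ℤ → Ω → ℝ) (g : ℤ → E → Ω → ℝ)
    (hZ : IsInnovation P Z)
    (hX : ∀ t ω, X t ω = √(S t ω) * Z t ω)
    (hΘ : IsCompact Θ) (hθ₀ : θ₀ ∈ Θ)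
    (hK : K ⊆ M.h.target)
    (hcont : M.PreservesContSpace Θ K P X)
    (hST : M.ST θ₀ P Z S)
    (hinv : M.ContinuouslyInvertible Θ K P X g)
    (hLB : M.LB K)
    (hID : M.ID θ₀ Θ P (g 0) (S 0))
    (u : E → ℝ) (hu : u ∈ VolatilityModel.contSpace Θ K)
    (θhat : ℕ → Ω → E)
    (hθhat : ∀ n, 1 ≤ n → ∀ᵐ ω ∂P, M.IsQMLE Θ (fun s => X s ω) u n (θhat n ω)) :
    ∀ᵐ ω ∂P, Tendsto (fun n => θhat n ω) atTop (𝓝 θ₀) := by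
  -- Only the countably many radii `1 / (j + 1)` are used, so that one null set serves for all of
  -- them.
  have hsep : ∀ j : ℕ, ∀ᵐ ω ∂P, ∀ᶠ n in atTop,
      ∀ θ ∈ Θ \ Metric.ball θ₀ (1 / ((j : ℝ) + 1)),
        M.quasiLik (fun s => X s ω) u n θ₀ < M.quasiLik (fun s => X s ω) u n θ := by
    intro j
    -- Compactness reduces uniform separation outside the ball to finitely many local separations.
    refine (hΘ.diff Metric.isOpen_ball).induction_on (p := fun A => ∀ᵐ ω ∂P, ∀ᶠ n in atTop,
      ∀ θ ∈ A, M.quasiLik (fun s => X s ω) u n θ₀ < M.quasiLik (fun s => X s ω) u n θ)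
      (by simp) ?_ ?_ ?_
    · intro A B hAB hB
      filter_upwards [hB] with ω hω
      filter_upwards [hω] with n hn θ hθ using hn θ (hAB hθ)
    · intro A B hA hB
      filter_upwards [hA, hB] with ω hω1 hω2
      filter_upwards [hω1, hω2] with n hn1 hn2 θ hθ
      exact hθ.elim (hn1 θ) (hn2 θ)
    · intro θ hθ
      have hne : θ ≠ θ₀ := fun h => hθ.2 (h ▸ Metric.mem_ball_self Nat.one_div_pos_of_nat)
      obtain ⟨δ, hδ, hball⟩ := hinv.exists_ball_quasiLik_lt hcont hST hZ hX hΘ hLB hID hu hθ₀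
        hθ.1 hne
      refine ⟨_, inter_mem_nhdsWithin _ (Metric.ball_mem_nhds θ hδ), ?_⟩
      filter_upwards [hball] with ω hω
      filter_upwards [hω] with n hn θ' hθ' using hn θ' hθ'.1.1 hθ'.2
  filter_upwards [ae_all_iff.2 hsep, ae_all_iff.2 fun n => ae_all_iff.2 (hθhat n)] with ω h1 h2
  rw [Metric.tendsto_nhds]
  intro ε hε
  obtain ⟨j, hj⟩ := exists_nat_one_div_lt hε
  filter_upwards [h1 j, eventually_ge_atTop 1] with n hn hn1
  obtain ⟨hmem, hmin⟩ := h2 n hn1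
  by_contra hfar
  refine absurd (hmin θ₀ hθ₀) (not_le.2 (hn _ ⟨hmem, fun hb => hfar ?_⟩))
  exact (Metric.mem_ball.1 hb).trans hj
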